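/- Let $K$ be a field of characteristic $0$ and let $\mathfrak g=\bigoplus_{p\in\mathbb Z}\mathfrak g_p$ be a finite-dimensional $\mathbb Z$-graded Lie algebra over $K$ (so $[\mathfrak g_p,\mathfrak g_q]\subseteq\mathfrak g_{p+q}$ for all $p,q\in\mathbb Z$). Assume that $\mathfrak g$ is decomposable, i.e. that for every $X\in\mathfrak g$ the semisimple and the nilpotent component in the Jordan–Chevalley decomposition of $\operatorname{ad}X\in\mathfrak{gl}_K(\mathfrak g)$ are again inner derivations of $\mathfrak g$. Let $\mathfrak n$ be the maximal nilpotent ideal of $\mathfrak g$. Then $\mathfrak g$ has a $\mathbb Z$-graded reductive Levi factor, that is, there is a Lie subalgebra $\mathfrak l\subseteq\mathfrak g$ which is a reductive Lie algebra (its adjoint representation is completely reducible), is a vector space complement of $\mathfrak n$ (that is, $\mathfrak g=\mathfrak l\oplus\mathfrak n$), and is graded: $\mathfrak l=\bigoplus_{p\in\mathbb Z}(\mathfrak l\cap\mathfrak g_p)$. -/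

import Mathlib

/-- `(S, N)` is the Jordan-Chevalley decomposition of the endomorphism `A`: `S` is semisimple,
`N` is nilpotent, they commute, and `A = S + N`. -/
structure IsJordanChevalley {K V : Type*} [Field K] [AddCommGroup V] [Module K V]
    (A S N : Module.End K V) : Prop where
  semisimple : S.IsSemisimple
  nilpotent : IsNilpotent N
  commute : Commute S N
  add_eq : A = S + N

section

attribute [local instance 100] LieRing.ofAssociativeRing

/-- A Lie subalgebra of `𝔤𝔩(V)` is decomposable in `V` if it contains the semisimple and the
nilpotent components of each of its elements. -/
def IsDecomposableIn {K V : Type*} [Field K] [AddCommGroup V] [Module K V]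
    (h : LieSubalgebra K (Module.End K V)) : Prop :=
  ∀ A ∈ h, ∀ S N : Module.End K V, IsJordanChevalley A S N → S ∈ h ∧ N ∈ h

/-- A Lie algebra is decomposable if the semisimple and nilpotent components of its inner
derivations are inner derivations, i.e. if `ad 𝔤` is decomposable in `𝔤`. -/
def IsDecomposableLie (K L : Type*) [Field K] [LieRing L] [LieAlgebra K L] : Prop :=
  IsDecomposableIn (LieAlgebra.ad K L).range

end

/-- A Lie algebra is reductive if its adjoint representation is completely reducible, i.e. if
every ideal has a complementary ideal. -/
def IsReductiveLie (K L : Type*) [Field K] [LieRing L] [LieAlgebra K L] : Prop :=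
  ComplementedLattice (LieIdeal K L)

/-- The maximal nilpotent ideal of a finite-dimensional Lie algebra: the sum of all the ideals
that are nilpotent as Lie algebras. (Mathlib's `LieAlgebra.maxNilpotentIdeal` is a different
object: it is the largest ideal that is nilpotent as a module over the whole algebra.) -/
def nilIdeal (K L : Type*) [Field K] [LieRing L] [LieAlgebra K L] : LieIdeal K L :=
  sSup {I : LieIdeal K L | LieRing.IsNilpotent I}

/-! Write `g` for the algebra, `r` for its radical and `n` for its maximal nilpotent ideal. By Lie's
theorem `[g, r]` acts nilpotently, whence `[g, r] ⊆ n`, and `n` is the set of ad-nilpotent elements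
of `r` (`mem_nilIdeal_iff`).

Among the commuting ad-semisimple subspaces of `r ∩ g_0`, take a maximal one, `t`
(`exists_maximal_torus`). Its centralizer in `r` lies in `t + n`: it is graded; in degree `p ≠ 0`
every element is ad-nilpotent; in degree `0` decomposability provides a semisimple part in `r ∩ g_0`
that commutes with `t`, hence lies in `t` by maximality. The Fitting decomposition under `t` gives
`g = c + n`, where `c` is the centralizer of `t` in `g` (`exists_centralizer_add_nilIdeal`).

So `c` maps onto `g / r` and contains a graded Levi subalgebra `s` (`exists_homogeneous_levi`). If
`t'` complements `t ∩ n` in `t`, then `l = s + t'` is graded and complements `n`. It is reductive by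
Weyl's theorem, since `t'` is central in it.

The graded Levi theorem rests on Whitehead's second lemma. That lemma yields a projection onto the
kernel that is a derivation modulo brackets of the kernel. This condition survives passage to the
degree zero part, which makes the resulting subalgebra graded. -/

/-! ### Cartan's criterion and the Casimir element. -/

section SemisimpleRepresentations

open LieAlgebra LieModule Module

attribute [local instance 100] LieRing.ofAssociativeRing

/-- A Lie algebra with a faithful representation whose trace form vanishes is solvable. -/
theorem isSolvable_of_traceForm_eq_zero {K L M : Type*} [Field K] [CharZero K] [LieRing L]
    [LieAlgebra K L] [FiniteDimensional K L] [AddCommGroup M] [Module K M]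
    [FiniteDimensional K M] [LieRingModule L M] [LieModule K L M] (h : traceForm K L M = 0)
    (hinj : Function.Injective (toEnd K L M)) : IsSolvable L := by
  have hn := isNilpotent_derivedSeries_of_traceForm_eq_zero h
  rw [isNilpotent_iff_forall' (R := K)] at hn
  set D : LieIdeal K L := derivedSeries K L 1 with hD
  have hDn : LieRing.IsNilpotent D := by
    rw [LieAlgebra.isNilpotent_iff_forall (R := K)]
    intro x
    obtain ⟨k, hk⟩ := LieAlgebra.ad_nilpotent_of_nilpotent (R := K) (hn x)
    -- By faithfulness `ad x` on `D` is a restriction of the commutator with the nilpotent operator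
    -- of `x`, so it is nilpotent and Engel's theorem applies to `D`.
    have key : ∀ (n : ℕ) (y : D), toEnd K L M (((ad K D x) ^ n) y : D) =
        ((ad K (End K M) (toEnd K D M x)) ^ n) (toEnd K L M y) := by
      intro n
      induction n with
      | zero => intro y; simp
      | succ n ih =>
        intro y
        rw [pow_succ, pow_succ, Module.End.mul_apply, Module.End.mul_apply, ih]
        congr 1
        change toEnd K L M ⁅(x : L), (y : L)⁆ = _
        rw [LieHom.map_lie]
        rfl
    refine ⟨k, ?_⟩
    ext y
    have := key k y
    rw [hk, LinearMap.zero_apply, ← map_zero (toEnd K L M)] at this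
    exact hinj this
  obtain ⟨k, hk⟩ := IsSolvable.solvable K D
  rw [LieIdeal.derivedSeries_eq_bot_iff] at hk
  refine IsSolvable.mk (R := K) (k := k + 1) ?_
  rwa [derivedSeries_def, derivedSeriesOfIdeal_add]

/-- The Casimir element of an irreducible nonzero representation `ρ` of a semisimple Lie algebra,
as an invariant tensor `∑ i, e i ⊗ e' i` that acts bijectively. -/
theorem exists_casimir {K S V : Type*} [Field K] [CharZero K] [LieRing S] [LieAlgebra K S]
    [FiniteDimensional K S] [HasTrivialRadical K S] [AddCommGroup V] [Module K V]
    [FiniteDimensional K V] (ρ : S →ₗ⁅K⁆ End K V)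
    (hirr : ∀ N : Submodule K V, (∀ x, ∀ v ∈ N, ρ x v ∈ N) → N = ⊥ ∨ N = ⊤)
    (hne : ∃ x, ρ x ≠ 0) :
    ∃ (n : ℕ) (e e' : Fin n → S),
      (∀ (β : S →ₗ[K] S →ₗ[K] V) (x : S), ∑ i, (β ⁅x, e i⁆ (e' i) + β (e i) ⁅x, e' i⁆) = 0) ∧
      (∀ x v, ρ x ((∑ i, ρ (e i) * ρ (e' i) : End K V) v) =
        (∑ i, ρ (e i) * ρ (e' i) : End K V) (ρ x v)) ∧
      Function.Bijective (∑ i, ρ (e i) * ρ (e' i) : End K V) := by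
  let _ : LieRingModule S V := LieRingModule.compLieHom V ρ
  have _ : LieModule K S V := LieModule.compLieHom V ρ
  have hρ : ∀ x, toEnd K S V x = ρ x := fun x ↦ rfl
  set I : LieIdeal K S := ρ.ker
  set J : LieIdeal K S := I.killingCompl
  have hIJ : IsCompl I J := I.isCompl_killingCompl
  have hI : ∀ x ∈ I, ρ x = 0 := fun x hx ↦ by simpa [I] using hx
  set B := traceForm K S V
  have hBI : ∀ x, ∀ y ∈ I, B x y = 0 := fun x y hy ↦ by
    simp [B, traceForm_apply_apply, hρ, hI y hy]
  have hsplit : ∀ x : S, ∃ i ∈ I, ∃ j ∈ J, i + j = x := fun x ↦ by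
    have : x ∈ I ⊔ J := hIJ.sup_eq_top ▸ LieSubmodule.mem_top x
    rwa [LieSubmodule.mem_sup] at this
  set Q : LieIdeal K S :=
    InvariantForm.orthogonal B (traceForm_lieInvariant K S V) ⊤ ⊓ J
  have hQ : Q = ⊥ := by
    -- `ρ` is faithful on `J`, and the trace form vanishes on `Q`, the part of its radical lying in
    -- `J`. Hence the trace form is nondegenerate on `J`.
    have : IsSolvable Q := by
      refine isSolvable_of_traceForm_eq_zero (K := K) (M := V) ?_ ?_
      · ext x y
        have := ((InvariantForm.mem_orthogonal _ _ _ _).mp x.2.1) y (LieSubmodule.mem_top _)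
        rw [traceForm_comm]
        exact this
      · rw [injective_iff_map_eq_zero]
        intro x hx
        have h1 : (x : S) ∈ I := by
          change ρ x = 0
          exact hx
        have h2 : (x : S) ∈ I ⊓ J := ⟨h1, x.2.2⟩
        rw [hIJ.inf_eq_bot] at h2
        exact Subtype.ext (by simpa using h2)
    exact HasTrivialRadical.eq_bot_of_isSolvable Q
  set BJ := B.restrict J.toSubmodule
  have hsym : BJ.IsSymm := ⟨fun x y ↦ traceForm_comm K S V x y⟩
  have hBJ : BJ.Nondegenerate := by
    refine hsym.isRefl.nondegenerate_iff_separatingLeft.mpr ?_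
    intro x hx
    have : (x : S) ∈ Q := by
      refine ⟨?_, x.2⟩
      change (x : S) ∈ InvariantForm.orthogonal B _ ⊤
      rw [InvariantForm.mem_orthogonal]
      intro y _
      obtain ⟨i, hi, j, hj, rfl⟩ := hsplit y
      rw [traceForm_comm, map_add, hBI _ _ hi, zero_add]
      exact hx ⟨j, hj⟩
    rw [hQ] at this
    exact Subtype.ext (by simpa using this)
  set b := Module.finBasis K J.toSubmodule
  set b' := BJ.dualBasis hBJ b
  have hb' : ∀ y ∈ J, y = ∑ j, B y (b j) • (b' j : S) := by
    intro y hy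
    have := b'.sum_repr ⟨y, hy⟩
    simp only [b', LinearMap.BilinForm.dualBasis_repr_apply] at this
    have := congrArg J.toSubmodule.subtype this
    rw [map_sum] at this
    exact this.symm
  have hb : ∀ y ∈ J, y = ∑ j, B (b' j) y • (b j : S) := by
    intro y hy
    have key : (LinearMap.id : J.toSubmodule →ₗ[K] J.toSubmodule) =
        ∑ j, (BJ (b' j)).smulRight (b j) := by
      refine b.ext fun i ↦ ?_
      simp [b', LinearMap.BilinForm.apply_dualBasis_left]
    have := congrArg J.toSubmodule.subtype (LinearMap.congr_fun key ⟨y, hy⟩)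
    rw [LinearMap.sum_apply, map_sum] at this
    exact this
  -- Invariance of the trace form makes the matrices of `ad x` in the dual bases negative transposes
  -- of each other, so the terms cancel in pairs.
  have hinv : ∀ (β : S →ₗ[K] S →ₗ[K] V) (x : S),
      ∑ i, (β ⁅x, (b i : S)⁆ (b' i) + β (b i) ⁅x, (b' i : S)⁆) = 0 := by
    intro β x
    have h1 : ∀ i, β ⁅x, (b i : S)⁆ (b' i) = ∑ j, B (b' j) ⁅x, (b i : S)⁆ • β (b j) (b' i) := by
      intro i
      conv_lhs => rw [hb ⁅x, (b i : S)⁆ (J.lie_mem (b i).2)]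
      simp
    have h2 : ∀ i, β (b i) ⁅x, (b' i : S)⁆ = ∑ j, B ⁅x, (b' i : S)⁆ (b j) • β (b i) (b' j) := by
      intro i
      conv_lhs => rw [hb' ⁅x, (b' i : S)⁆ (J.lie_mem (b' i).2)]
      simp
    rw [Finset.sum_add_distrib, Finset.sum_congr rfl fun i _ ↦ h1 i,
      Finset.sum_congr rfl fun i _ ↦ h2 i, Finset.sum_comm, ← Finset.sum_add_distrib]
    refine Finset.sum_eq_zero fun j _ ↦ ?_
    rw [← Finset.sum_add_distrib]
    refine Finset.sum_eq_zero fun i _ ↦ ?_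
    rw [← add_smul]
    have := traceForm_apply_lie_apply K S V (b' j : S) x (b i : S)
    have h3 : B ⁅x, (b' j : S)⁆ (b i) = - B ⁅(b' j : S), x⁆ (b i) := by
      rw [← lie_skew, map_neg, LinearMap.neg_apply]
    rw [h3, this, add_neg_cancel, zero_smul]
  refine ⟨_, fun i ↦ (b i : S), fun i ↦ (b' i : S), hinv, ?_⟩
  set Ω : End K V := ∑ i, ρ (b i) * ρ (b' i)
  have hcomm : ∀ x v, ρ x (Ω v) = Ω (ρ x v) := by
    intro x v
    have := hinv (LinearMap.mk₂ K (fun a c ↦ ρ a (ρ c v)) (by simp) (by simp) (by simp)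
      (by simp)) x
    simp only [LinearMap.mk₂_apply, LieHom.map_lie, Ring.lie_def, LinearMap.sub_apply,
      Module.End.mul_apply, map_sub, sub_add_sub_cancel, Finset.sum_sub_distrib] at this
    simpa [Ω, LinearMap.sum_apply, sub_eq_zero] using this
  have hker : LinearMap.ker Ω = ⊥ := by
    refine (hirr (LinearMap.ker Ω) fun x v hv ↦ ?_).resolve_right fun h ↦ ?_
    · rw [LinearMap.mem_ker] at hv ⊢
      rw [← hcomm, hv, map_zero]
    · have hΩ : Ω = 0 := LinearMap.ker_eq_top.mp h
      -- Each pair of dual vectors contributes trace `1`. In characteristic `0`, `Ω = 0` would force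
      -- `J = ⊥`, that is, `ρ = 0`.
      have htr : LinearMap.trace K V Ω = finrank K J.toSubmodule := by
        simp only [Ω, map_sum]
        have : ∀ i, LinearMap.trace K V (ρ (b i) * ρ (b' i)) = 1 := fun i ↦ by
          have := LinearMap.BilinForm.apply_dualBasis_right (B := BJ) hBJ hsym b i i
          rw [if_pos rfl] at this
          exact this
        simp [this]
      rw [hΩ, map_zero] at htr
      have h0 : finrank K J.toSubmodule = 0 := by exact_mod_cast htr.symm
      have hJ : J = ⊥ := by
        rw [← LieSubmodule.toSubmodule_eq_bot]
        exact Submodule.finrank_eq_zero.mp h0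
      obtain ⟨x, hx⟩ := hne
      obtain ⟨i, hi, j, hj, rfl⟩ := hsplit x
      rw [hJ, LieSubmodule.mem_bot] at hj
      rw [hj, add_zero] at hx
      exact hx (hI i hi)
  exact ⟨hcomm, LinearMap.ker_eq_bot.mp hker,
    LinearMap.injective_iff_surjective.mp (LinearMap.ker_eq_bot.mp hker)⟩

end SemisimpleRepresentations

/-! ### Whitehead's lemmas, Weyl's theorem and splitting of abelian extensions. -/

section SemisimpleCohomology

open LieAlgebra LieModule Module

attribute [local instance 100] LieRing.ofAssociativeRing

/-- The restriction of a representation to an invariant subspace. -/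
def subRep {K S V : Type*} [Field K] [LieRing S] [LieAlgebra K S] [AddCommGroup V] [Module K V]
    (ρ : S →ₗ⁅K⁆ End K V) (N : Submodule K V) (hN : ∀ x, ∀ v ∈ N, ρ x v ∈ N) :
    S →ₗ⁅K⁆ End K N where
  toFun x := (ρ x).restrict (hN x)
  map_add' x y := by ext; simp
  map_smul' a x := by ext; simp
  map_lie' {x y} := by ext; simp [Ring.lie_def]

/-- The representation on the quotient by an invariant subspace. -/
def quotRep {K S V : Type*} [Field K] [LieRing S] [LieAlgebra K S] [AddCommGroup V] [Module K V]
    (ρ : S →ₗ⁅K⁆ End K V) (N : Submodule K V) (hN : ∀ x, ∀ v ∈ N, ρ x v ∈ N) :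
    S →ₗ⁅K⁆ End K (V ⧸ N) where
  toFun x := N.mapQ N (ρ x) (hN x)
  map_add' x y := by ext; simp
  map_smul' a x := by ext; simp
  map_lie' {x y} := by ext; simp [Ring.lie_def]

theorem lie_lie_jacobi {L : Type*} [LieRing L] (x y z : L) :
    ⁅⁅x, y⁆, z⁆ + ⁅⁅y, z⁆, x⁆ + ⁅⁅z, x⁆, y⁆ = 0 := by
  rw [← lie_skew ⁅x, y⁆ z, ← lie_skew ⁅y, z⁆ x, ← lie_skew ⁅z, x⁆ y, ← neg_add, ← neg_add,
    add_rotate, lie_jacobi, neg_zero]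

/-- This is the case split for inductions on dimension. The second alternative includes `V = 0`,
which later falls under the case `ρ = 0`. -/
theorem exists_invariant_or_irreducible {K S V : Type*} [Field K] [LieRing S] [LieAlgebra K S]
    [AddCommGroup V] [Module K V] (ρ : S →ₗ⁅K⁆ End K V) :
    (∃ N : Submodule K V, (∀ x, ∀ v ∈ N, ρ x v ∈ N) ∧ N ≠ ⊥ ∧ N ≠ ⊤) ∨
      ∀ N : Submodule K V, (∀ x, ∀ v ∈ N, ρ x v ∈ N) → N = ⊥ ∨ N = ⊤ := by
  by_contra! h
  obtain ⟨h1, N, hN, hb, ht⟩ := h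
  exact ht (h1 N hN hb)

theorem Submodule.finrank_quotient_lt_of_ne_bot {K V : Type*} [Field K] [AddCommGroup V]
    [Module K V] [FiniteDimensional K V] {N : Submodule K V} (hN : N ≠ ⊥) :
    finrank K (V ⧸ N) < finrank K V := by
  have := N.finrank_quotient_add_finrank
  have : finrank K N ≠ 0 := fun h ↦ hN (Submodule.finrank_eq_zero.mp h)
  omega

section

variable {K : Type*} {S : Type*} [Field K] [CharZero K] [LieRing S] [LieAlgebra K S]
  [FiniteDimensional K S] [HasTrivialRadical K S]

/-- A semisimple Lie algebra is perfect: linear maps that kill all brackets vanish. -/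
theorem eq_zero_of_map_lie_eq_zero {V : Type*} [AddCommGroup V] [Module K V] (c : S →ₗ[K] V)
    (hc : ∀ x y : S, c ⁅x, y⁆ = 0) : c = 0 := by
  set D : LieIdeal K S := ⁅(⊤ : LieIdeal K S), (⊤ : LieIdeal K S)⁆
  have hD : Dᶜ = ⊥ := by
    -- The brackets of the complementary ideal lie both in `D` and in `Dᶜ`.
    have : IsLieAbelian (Dᶜ : LieIdeal K S) := by
      rw [LieSubmodule.lie_abelian_iff_lie_self_eq_bot, eq_bot_iff, ← inf_compl_self D]
      exact le_inf (LieSubmodule.mono_lie le_top le_top) (LieSubmodule.lie_le_left _ _)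
    exact HasTrivialRadical.eq_bot_of_isSolvable _
  have hD' : D = ⊤ := compl_eq_bot.mp hD
  ext x
  have hx : x ∈ D.toSubmodule := by rw [hD']; trivial
  rw [LieSubmodule.lieIdeal_oper_eq_linear_span'] at hx
  have : D.toSubmodule ≤ LinearMap.ker c := by
    rw [LieSubmodule.lieIdeal_oper_eq_linear_span', Submodule.span_le]
    rintro _ ⟨a, -, b, -, rfl⟩
    exact hc a b
  rw [LieSubmodule.lieIdeal_oper_eq_linear_span'] at this
  exact this hx

/-- Whitehead's first lemma. -/
theorem exists_eq_apply_of_oneCocycle {V : Type*} [AddCommGroup V] [Module K V]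
    [FiniteDimensional K V] (ρ : S →ₗ⁅K⁆ End K V) (c : S →ₗ[K] V)
    (hc : ∀ x y : S, c ⁅x, y⁆ = ρ x (c y) - ρ y (c x)) : ∃ m, ∀ x, c x = ρ x m := by
  -- In the reducible case, solve in `V ⧸ N`, lift the solution and subtract its coboundary; the
  -- remaining cocycle takes values in `N`.
  rcases exists_invariant_or_irreducible ρ with ⟨N, hN, hb, ht⟩ | hirr
  · obtain ⟨m', hm'⟩ := exists_eq_apply_of_oneCocycle (quotRep ρ N hN) (N.mkQ ∘ₗ c)
      (fun x y ↦ by simp [hc, quotRep])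
    obtain ⟨m, rfl⟩ := N.mkQ_surjective m'
    have hcm : ∀ x, c x - ρ x m ∈ N := fun x ↦ by
      have := hm' x
      simpa [quotRep, Submodule.Quotient.eq] using this
    let c' : S →ₗ[K] N :=
      LinearMap.codRestrict N (c - (LinearMap.applyₗ m).comp (ρ : S →ₗ[K] End K V)) hcm
    have hc' : ∀ x, (c' x : V) = c x - ρ x m := fun x ↦ rfl
    obtain ⟨k, hk⟩ := exists_eq_apply_of_oneCocycle (subRep ρ N hN) c' (fun x y ↦ by
      ext
      simp only [hc', subRep, hc, LieHom.map_lie, Ring.lie_def]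
      simp [hc']
      abel)
    refine ⟨m + k, fun x ↦ ?_⟩
    have := congrArg Subtype.val (hk x)
    rw [hc'] at this
    rw [map_add, ← sub_eq_iff_eq_add', this]
    rfl
  · by_cases hne : ∃ x, ρ x ≠ 0
    · obtain ⟨n, e, e', hinv, hcomm, hbij⟩ := exists_casimir ρ hirr hne
      set Ω : End K V := ∑ i, ρ (e i) * ρ (e' i)
      -- Contracting the cocycle with the Casimir tensor gives a primitive of `Ω ∘ c`; as `Ω` is
      -- invertible and equivariant, it can be divided out.
      have hw : ∀ x, ρ x (∑ i, ρ (e i) (c (e' i))) = Ω (c x) := by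
        intro x
        have := hinv ((ρ : S →ₗ[K] End K V).compl₂ c) x
        simp only [LinearMap.compl₂_apply, LieHom.coe_toLinearMap, LieHom.map_lie, Ring.lie_def,
          LinearMap.sub_apply, Module.End.mul_apply, hc, map_sub, sub_add_sub_cancel,
          Finset.sum_sub_distrib] at this
        simpa [Ω, LinearMap.sum_apply, sub_eq_zero] using this
      obtain ⟨m, hm⟩ := hbij.2 (∑ i, ρ (e i) (c (e' i)))
      refine ⟨m, fun x ↦ hbij.1 ?_⟩
      rw [← hcomm, hm, hw]
    · push Not at hne
      refine ⟨0, fun x ↦ ?_⟩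
      rw [eq_zero_of_map_lie_eq_zero c fun x y ↦ by simp [hc, hne]]
      simp
termination_by finrank K V
decreasing_by
  · exact Submodule.finrank_quotient_lt_of_ne_bot hb
  · exact Submodule.finrank_lt ht

/-- The representation on the space of linear maps between two representations. -/
def homRep {V W : Type*} [AddCommGroup V] [Module K V] [AddCommGroup W] [Module K W]
    (ρ : S →ₗ⁅K⁆ End K V) (σ : S →ₗ⁅K⁆ End K W) : S →ₗ⁅K⁆ End K (V →ₗ[K] W) where
  toFun x := LinearMap.llcomp K V W W (σ x) - LinearMap.lcomp K W (ρ x)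
  map_add' x y := by ext; simp; abel
  map_smul' a x := by ext; simp [smul_sub]
  map_lie' {x y} := by ext; simp [Ring.lie_def]; abel

omit [CharZero K] [FiniteDimensional K S] [HasTrivialRadical K S] in
theorem homRep_apply {V W : Type*} [AddCommGroup V] [Module K V] [AddCommGroup W] [Module K W]
    (ρ : S →ₗ⁅K⁆ End K V) (σ : S →ₗ⁅K⁆ End K W) (x : S) (f : V →ₗ[K] W) (v : V) :
    homRep ρ σ x f v = σ x (f v) - f (ρ x v) := rfl

/-- Weyl's theorem on complete reducibility. -/
theorem exists_invariant_isCompl {V : Type*} [AddCommGroup V] [Module K V]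
    [FiniteDimensional K V] (ρ : S →ₗ⁅K⁆ End K V) (N : Submodule K V)
    (hN : ∀ x, ∀ v ∈ N, ρ x v ∈ N) :
    ∃ N' : Submodule K V, (∀ x, ∀ v ∈ N', ρ x v ∈ N') ∧ IsCompl N N' := by
  -- For a linear projection `π` onto `N`, the map `x ↦ x · π` is a cocycle with values in `P`.
  -- Writing it as `x · φ` with `φ ∈ P` makes `π - φ` an equivariant projection onto `N`.
  let P : Submodule K (V →ₗ[K] V) :=
    { carrier := {φ | (∀ v, φ v ∈ N) ∧ ∀ v ∈ N, φ v = 0}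
      add_mem' := fun ha hb ↦ ⟨fun v ↦ N.add_mem (ha.1 v) (hb.1 v),
        fun v hv ↦ by simp [ha.2 v hv, hb.2 v hv]⟩
      zero_mem' := ⟨fun v ↦ N.zero_mem, fun v _ ↦ rfl⟩
      smul_mem' := fun a φ h ↦ ⟨fun v ↦ N.smul_mem a (h.1 v), fun v hv ↦ by simp [h.2 v hv]⟩ }
  have hP : ∀ x, ∀ φ ∈ P, homRep ρ ρ x φ ∈ P := fun x φ h ↦
    ⟨fun v ↦ N.sub_mem (hN x _ (h.1 v)) (h.1 _),
      fun v hv ↦ by rw [homRep_apply, h.2 v hv, h.2 _ (hN x v hv)]; simp⟩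
  obtain ⟨g, hg⟩ := LinearMap.exists_leftInverse_of_injective N.subtype N.ker_subtype
  have hg' : ∀ v (hv : v ∈ N), g v = ⟨v, hv⟩ := fun v hv ↦ LinearMap.congr_fun hg ⟨v, hv⟩
  set π : V →ₗ[K] V := N.subtype ∘ₗ g
  have hπ : ∀ v ∈ N, π v = v := fun v hv ↦ by simp [π, hg' v hv]
  have hπN : ∀ v, π v ∈ N := fun v ↦ (g v).2
  let c : S →ₗ[K] P := LinearMap.codRestrict P
    ((LinearMap.applyₗ π).comp (homRep ρ ρ : S →ₗ[K] End K (V →ₗ[K] V))) fun x ↦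
      ⟨fun v ↦ N.sub_mem (hN x _ (hπN v)) (hπN _), fun v hv ↦ by
        change homRep ρ ρ x π v = 0
        rw [homRep_apply, hπ v hv, hπ _ (hN x v hv), sub_self]⟩
  have hc : ∀ x, (c x : V →ₗ[K] V) = homRep ρ ρ x π := fun x ↦ rfl
  obtain ⟨φ, hφ⟩ := exists_eq_apply_of_oneCocycle (subRep (homRep ρ ρ) P hP) c fun x y ↦ by
    ext1
    rw [hc, LieHom.map_lie]
    rfl
  set f : V →ₗ[K] V := π - φ
  have hf : ∀ x v, ρ x (f v) = f (ρ x v) := by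
    intro x v
    have h1 : homRep ρ ρ x π = homRep ρ ρ x φ := congrArg Subtype.val (hφ x)
    have h2 := LinearMap.congr_fun h1 v
    simp only [homRep_apply] at h2
    simp only [f, LinearMap.sub_apply, map_sub]
    rw [sub_eq_sub_iff_sub_eq_sub]
    exact h2
  have hfN : ∀ v ∈ N, f v = v := fun v hv ↦ by simp [f, hπ v hv, φ.2.2 v hv]
  have hfr : ∀ v, f v ∈ N := fun v ↦ N.sub_mem (hπN v) (φ.2.1 v)
  refine ⟨LinearMap.ker f, fun x v hv ↦ ?_, ?_, ?_⟩
  · rw [LinearMap.mem_ker] at hv ⊢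
    rw [← hf, hv, map_zero]
  · rw [Submodule.disjoint_def]
    intro v hv hv'
    rw [← hfN v hv]
    exact hv'
  · rw [codisjoint_iff, eq_top_iff]
    intro v _
    exact Submodule.mem_sup.mpr ⟨f v, hfr v, v - f v, by simp [hfN _ (hfr v)], by simp⟩

/-- Whitehead's second lemma. -/
theorem exists_eq_coboundary_of_twoCocycle {V : Type*} [AddCommGroup V] [Module K V]
    [FiniteDimensional K V] (ρ : S →ₗ⁅K⁆ End K V) (ω : S →ₗ[K] S →ₗ[K] V)
    (halt : ∀ x, ω x x = 0)
    (hω : ∀ x y z, ρ x (ω y z) + ρ y (ω z x) + ρ z (ω x y)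
      - ω ⁅x, y⁆ z - ω ⁅y, z⁆ x - ω ⁅z, x⁆ y = 0) :
    ∃ η : S →ₗ[K] V, ∀ x y, ω x y = ρ x (η y) - ρ y (η x) - η ⁅x, y⁆ := by
  have hskew : ∀ x y, ω y x = - ω x y := fun x y ↦ by
    have := halt (x + y)
    simp only [map_add, LinearMap.add_apply, halt, zero_add, add_zero] at this
    exact eq_neg_of_add_eq_zero_left this
  rcases exists_invariant_or_irreducible ρ with ⟨N, hN, hb, ht⟩ | hirr
  · obtain ⟨η', hη'⟩ := exists_eq_coboundary_of_twoCocycle (quotRep ρ N hN) (ω.compr₂ N.mkQ)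
      (fun x ↦ by simp [halt]) (fun x y z ↦ by
        have := congrArg N.mkQ (hω x y z)
        simpa [quotRep] using this)
    obtain ⟨η, hη⟩ := Module.projective_lifting_property N.mkQ η' N.mkQ_surjective
    have hηx : ∀ x, η' x = N.mkQ (η x) := fun x ↦ by rw [← hη]; rfl
    have hmem : ∀ x y, ω x y - (ρ x (η y) - ρ y (η x) - η ⁅x, y⁆) ∈ N := fun x y ↦ by
      rw [← Submodule.Quotient.eq]
      have := hη' x y
      simp only [hηx] at this
      simpa [quotRep] using this
    let ω' : S →ₗ[K] S →ₗ[K] N := LinearMap.mk₂ K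
      (fun x y ↦ ⟨ω x y - (ρ x (η y) - ρ y (η x) - η ⁅x, y⁆), hmem x y⟩)
      (fun x y z ↦ by ext; simp; abel) (fun a x y ↦ by ext; simp [smul_sub])
      (fun x y z ↦ by ext; simp; abel) (fun a x y ↦ by ext; simp [smul_sub])
    have hω' : ∀ x y, (ω' x y : V) = ω x y - (ρ x (η y) - ρ y (η x) - η ⁅x, y⁆) :=
      fun x y ↦ rfl
    obtain ⟨k, hk⟩ := exists_eq_coboundary_of_twoCocycle (subRep ρ N hN) ω'
      (fun x ↦ by ext; simp [hω', halt]) (fun x y z ↦ by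
        have h1 := hω x y z
        have h2 : η ⁅⁅x, y⁆, z⁆ + η ⁅⁅y, z⁆, x⁆ + η ⁅⁅z, x⁆, y⁆ = 0 := by
          rw [← map_add, ← map_add, lie_lie_jacobi, map_zero]
        have h3 : ∀ a v, ((subRep ρ N hN a v : N) : V) = ρ a v := fun a v ↦ rfl
        ext
        simp only [Submodule.coe_sub, Submodule.coe_add, h3, hω', LieHom.map_lie, Ring.lie_def,
          LinearMap.sub_apply, Module.End.mul_apply, map_sub, Submodule.coe_zero]
        rw [← sub_eq_zero.mpr h1, ← sub_eq_zero.mpr h2]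
        abel)
    refine ⟨η + N.subtype ∘ₗ k, fun x y ↦ ?_⟩
    have h1 := congrArg Subtype.val (hk x y)
    rw [hω'] at h1
    have h2 : ω x y = ρ x (k y) - ρ y (k x) - k ⁅x, y⁆ + (ρ x (η y) - ρ y (η x) - η ⁅x, y⁆) :=
      sub_eq_iff_eq_add.mp h1
    rw [h2]
    simp
    abel
  · by_cases hne : ∃ x, ρ x ≠ 0
    · obtain ⟨n, e, e', hinv, hcomm, hbij⟩ := exists_casimir ρ hirr hne
      set Ω : End K V := ∑ i, ρ (e i) * ρ (e' i)
      -- The same contraction as for one-cocycles, now in the first argument of `ω`; its coboundary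
      -- is `Ω ∘ ω`.
      let w : S →ₗ[K] V := ∑ i, ρ (e i) ∘ₗ ω (e' i)
      have hw : ∀ y, w y = ∑ i, ρ (e i) (ω (e' i) y) := fun y ↦ by simp [w]
      have hdw : ∀ x y, ρ x (w y) - ρ y (w x) - w ⁅x, y⁆ = Ω (ω x y) := by
        intro x y
        have h1 := hinv ((ρ : S →ₗ[K] End K V).compl₂ (ω.flip y)) x
        have h2 := hinv ((ρ : S →ₗ[K] End K V).compl₂ (ω.flip x)) y
        simp only [LinearMap.compl₂_apply, LieHom.coe_toLinearMap, LieHom.map_lie, Ring.lie_def,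
          LinearMap.sub_apply, Module.End.mul_apply, LinearMap.flip_apply] at h1 h2
        simp only [hw, Ω, LinearMap.sum_apply, map_sum, Module.End.mul_apply]
        rw [← sub_eq_zero, ← sub_eq_zero.mpr (h1.trans h2.symm)]
        simp only [← Finset.sum_sub_distrib]
        refine Finset.sum_congr rfl fun i _ ↦ ?_
        have h3 := congrArg (ρ (e i)) (hω x y (e' i))
        rw [hskew (e' i) y, hskew (e' i) ⁅x, y⁆, ← lie_skew (e' i) x] at h3
        simp only [map_add, map_sub, map_neg, map_zero, LinearMap.neg_apply] at h3
        linear_combination (norm := module) -h3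
      let E : V ≃ₗ[K] V := LinearEquiv.ofBijective Ω hbij
      have hE : ∀ v, Ω (E.symm v) = v := fun v ↦ E.apply_symm_apply v
      refine ⟨E.symm.toLinearMap ∘ₗ w, fun x y ↦ hbij.1 ?_⟩
      simp only [map_sub, ← hcomm, LinearMap.comp_apply, LinearEquiv.coe_coe, hE, hdw]
    · push Not at hne
      -- When `S` acts trivially on `V`, the two-cocycle is a one-cocycle with values in `Hom(S,
      -- V)`, so the first lemma applies.
      obtain ⟨φ, hφ⟩ := exists_eq_apply_of_oneCocycle (homRep (LieAlgebra.ad K S) ρ) ω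
        (fun x y ↦ by
          ext z
          have := hω x y z
          simp only [hne, LinearMap.zero_apply, zero_add, zero_sub] at this
          simp only [LinearMap.sub_apply, homRep_apply, hne, LinearMap.zero_apply]
          rw [hskew x ⁅y, z⁆, hskew y ⁅z, x⁆, ← lie_skew z x, map_neg] at this
          rw [ad_apply, ad_apply]
          linear_combination (norm := module) -this)
      refine ⟨φ, fun x y ↦ ?_⟩
      rw [hφ, homRep_apply]
      simp [hne]
termination_by finrank K V
decreasing_by
  · exact Submodule.finrank_quotient_lt_of_ne_bot hb
  · exact Submodule.finrank_lt ht

/-- An extension of a semisimple Lie algebra by an abelian ideal splits. -/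
theorem exists_lieHom_section_of_abelian_ker {G : Type*} [LieRing G] [LieAlgebra K G]
    [FiniteDimensional K G] (p : G →ₗ⁅K⁆ S) (hp : Function.Surjective p)
    (hab : ∀ a b : G, p a = 0 → p b = 0 → ⁅a, b⁆ = 0) :
    ∃ σ : S →ₗ⁅K⁆ G, ∀ x, p (σ x) = x := by
  obtain ⟨τ, hτ⟩ := LinearMap.exists_rightInverse_of_surjective (p : G →ₗ[K] S)
    (LinearMap.range_eq_top.mpr hp)
  have hτ : ∀ x, p (τ x) = x := fun x ↦ LinearMap.congr_fun hτ x
  let V : Submodule K G := LinearMap.ker (p : G →ₗ[K] S)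
  have hV : ∀ {v : G}, v ∈ V ↔ p v = 0 := Iff.rfl
  -- The linear section `τ` acts on the kernel; its failure to be a homomorphism takes values in the
  -- kernel, which is abelian, so the action is a representation.
  let ρ : S →ₗ⁅K⁆ End K V :=
    { toFun := fun x ↦ (ad K G (τ x)).restrict fun v (hv : p v = 0) ↦ show p _ = 0 by simp [hv]
      map_add' := fun x y ↦ LinearMap.ext fun v ↦ Subtype.ext <| by
        change ⁅τ (x + y), (v : G)⁆ = ⁅τ x, (v : G)⁆ + ⁅τ y, (v : G)⁆
        rw [map_add, add_lie]
      map_smul' := fun a x ↦ LinearMap.ext fun v ↦ Subtype.ext <| by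
        change ⁅τ (a • x), (v : G)⁆ = a • ⁅τ x, (v : G)⁆
        rw [map_smul, smul_lie]
      map_lie' := fun {x y} ↦ by
        ext ⟨v, hv⟩
        have := hab (τ ⁅x, y⁆ - ⁅τ x, τ y⁆) v (by simp [hτ]) hv
        rw [sub_lie, sub_eq_zero] at this
        change ⁅τ ⁅x, y⁆, v⁆ = ⁅τ x, ⁅τ y, v⁆⁆ - ⁅τ y, ⁅τ x, v⁆⁆
        rw [this, lie_lie] }
  have hρ : ∀ x v, (ρ x v : G) = ⁅τ x, (v : G)⁆ := fun x v ↦ rfl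
  let ω : S →ₗ[K] S →ₗ[K] V := LinearMap.mk₂ K
    (fun x y ↦ ⟨⁅τ x, τ y⁆ - τ ⁅x, y⁆, show p _ = 0 by simp [hτ]⟩)
    (fun x y z ↦ by ext; simp; abel) (fun a x y ↦ by ext; simp [smul_sub])
    (fun x y z ↦ by ext; simp; abel) (fun a x y ↦ by ext; simp [smul_sub])
  have hωx : ∀ x y, (ω x y : G) = ⁅τ x, τ y⁆ - τ ⁅x, y⁆ := fun x y ↦ rfl
  obtain ⟨η, hη⟩ := exists_eq_coboundary_of_twoCocycle ρ ω (fun x ↦ by ext; simp [hωx])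
    (fun x y z ↦ by
      have h1 := lie_jacobi (τ x) (τ y) (τ z)
      have h2 : τ ⁅⁅x, y⁆, z⁆ + τ ⁅⁅y, z⁆, x⁆ + τ ⁅⁅z, x⁆, y⁆ = 0 := by
        rw [← map_add, ← map_add, lie_lie_jacobi, map_zero]
      ext
      simp only [Submodule.coe_sub, Submodule.coe_add, hρ, hωx, lie_sub, Submodule.coe_zero]
      rw [← lie_skew (τ ⁅x, y⁆) (τ z), ← lie_skew (τ ⁅y, z⁆) (τ x), ← lie_skew (τ ⁅z, x⁆) (τ y)]
      linear_combination (norm := module) h1 + h2)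
  refine ⟨{ (τ - V.subtype ∘ₗ η) with map_lie' := ?_ }, fun x ↦ ?_⟩
  · intro x y
    have h1 := congrArg Subtype.val (hη x y)
    have h2 := hab (η x) (η y) (hV.mp (η x).2) (hV.mp (η y).2)
    simp only [hωx, hρ, Submodule.coe_sub] at h1
    change τ ⁅x, y⁆ - η ⁅x, y⁆ = ⁅τ x - η x, τ y - η y⁆
    rw [lie_sub, sub_lie, sub_lie, h2, ← lie_skew (η x : G) (τ y)]
    linear_combination (norm := module) -h1
  · have : p (η x : G) = 0 := hV.mp (η x).2
    change p (τ x - η x) = x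
    rw [map_sub, this, hτ, sub_zero]

end

end SemisimpleCohomology

/-! ### Lie's theorem, the radical and the maximal nilpotent ideal. -/

section Radicals

open LieAlgebra LieModule Module

attribute [local instance 100] LieRing.ofAssociativeRing

/-- An endomorphism that vanishes on an invariant subspace and is nilpotent on the quotient is
nilpotent. -/
theorem isNilpotent_of_mapQ {K V : Type*} [Field K] [AddCommGroup V] [Module K V]
    {N : Submodule K V} {f : End K V} (hN : ∀ v ∈ N, f v = 0) (hN' : N ≤ N.comap f)
    (hq : IsNilpotent (N.mapQ N f hN')) : IsNilpotent f := by
  obtain ⟨k, hk⟩ := hq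
  refine ⟨k + 1, ?_⟩
  ext v
  rw [pow_succ', Module.End.mul_apply]
  apply hN
  rw [← Submodule.Quotient.mk_eq_zero, ← Submodule.mkQ_apply]
  have : ∀ n w, N.mkQ ((f ^ n) w) = ((N.mapQ N f hN') ^ n) (N.mkQ w) := by
    intro n
    induction n with
    | zero => intro w; rfl
    | succ n ih => intro w; rw [pow_succ, pow_succ, Module.End.mul_apply, ih]; rfl
  rw [this, hk, LinearMap.zero_apply]

/-- By Lie's theorem `R` has a nonzero weight space, and it is stable under `L`. There `[x, y]` with
`y ∈ R` acts by a scalar; being a commutator it has trace `0`, so the scalar vanishes in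
characteristic `0`. Induction on dimension treats the quotient. -/
theorem isNilpotent_toEnd_of_mem_lie_solvable_of_isAlgClosed {A L V : Type*} [Field A]
    [CharZero A] [IsAlgClosed A] [LieRing L] [LieAlgebra A L] [FiniteDimensional A L]
    (R : LieIdeal A L) [LieAlgebra.IsSolvable R] [AddCommGroup V] [Module A V]
    [FiniteDimensional A V] [LieRingModule L V] [LieModule A L V] {z : L}
    (hz : z ∈ ⁅(⊤ : LieIdeal A L), R⁆) : _root_.IsNilpotent (toEnd A L V z) := by
  rcases subsingleton_or_nontrivial V with hV | hV
  · exact ⟨1, LinearMap.ext fun v ↦ Subsingleton.elim _ _⟩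
  obtain ⟨χ, hχ⟩ := exists_nontrivial_weightSpace_of_isSolvable A R V
  let N : LieSubmodule A L V := weightSpaceOfIsLieTower A V χ
  have hN0 : Nontrivial N := hχ
  have hN : ∀ v ∈ N, ∀ y (hy : y ∈ R), ⁅y, v⁆ = χ ⟨y, hy⟩ • v := fun v hv y hy ↦
    (mem_weightSpace χ v).mp hv ⟨y, hy⟩
  have hlie : ∀ x : L, ∀ y (hy : y ∈ R), χ ⟨⁅x, y⁆, R.lie_mem hy⟩ = 0 := by
    intro x y hy
    have h1 : toEnd A L N ⁅x, y⁆ = χ ⟨⁅x, y⁆, R.lie_mem hy⟩ • LinearMap.id := by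
      ext v
      exact hN v v.2 _ _
    have h2 := LinearMap.trace_lie (R := A) (toEnd A L N x) (toEnd A L N y)
    rw [← LieHom.map_lie, h1, map_smul, LinearMap.trace_id, smul_eq_mul] at h2
    refine (mul_eq_zero.mp h2).resolve_right ?_
    exact_mod_cast (finrank_pos (R := A) (M := N)).ne'
  have hker : ∀ v ∈ N, ⁅z, v⁆ = 0 := by
    rw [← LieSubmodule.mem_toSubmodule, LieSubmodule.lieIdeal_oper_eq_linear_span'] at hz
    intro v hv
    induction hz using Submodule.span_induction with
    | mem w hw =>
      obtain ⟨x, -, y, hy, rfl⟩ := hw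
      rw [hN v hv _ (R.lie_mem hy), hlie x y hy, zero_smul]
    | zero => simp
    | add a b _ _ ha hb => rw [add_lie, ha, hb, add_zero]
    | smul a b _ hb => rw [smul_lie, hb, smul_zero]
  have : finrank A (V ⧸ N) < finrank A V :=
    Submodule.finrank_quotient_lt_of_ne_bot (N := N.toSubmodule) fun h ↦ by
      obtain ⟨v, hv⟩ := exists_ne (0 : N)
      have : (v : V) ∈ N.toSubmodule := v.2
      rw [h, Submodule.mem_bot] at this
      exact hv (Subtype.ext this)
  have hq := isNilpotent_toEnd_of_mem_lie_solvable_of_isAlgClosed R (V := V ⧸ N) hz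
  exact isNilpotent_of_mapQ (N := N.toSubmodule) hker (fun v hv ↦ N.lie_mem hv) hq
termination_by finrank A V

section

variable {K L : Type*} [Field K] [CharZero K] [LieRing L] [LieAlgebra K L]
  [FiniteDimensional K L]

open TensorProduct in
/-- Elements of `[L, rad L]` act nilpotently. -/
theorem isNilpotent_ad_of_mem_lie_radical {z : L}
    (hz : z ∈ ⁅(⊤ : LieIdeal K L), radical K L⁆) : _root_.IsNilpotent (ad K L z) := by
  -- Lie's theorem needs eigenvalues. Solvability passes up to the algebraic closure, and nilpotency
  -- of the operator descends from it.
  let A := AlgebraicClosure K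
  let R : LieIdeal A (A ⊗[K] L) := (radical K L).baseChange A
  have : LieAlgebra.IsSolvable R := by
    obtain ⟨k, hk⟩ := IsSolvable.solvable K (radical K L)
    rw [LieIdeal.derivedSeries_eq_bot_iff] at hk
    refine IsSolvable.mk (R := A) (k := k) ?_
    rw [LieIdeal.derivedSeries_eq_bot_iff, derivedSeriesOfIdeal_baseChange, hk,
      LieSubmodule.baseChange_bot]
  have hz' : (1 : A) ⊗ₜ[K] z ∈ ⁅(⊤ : LieIdeal A (A ⊗[K] L)), R⁆ := by
    rw [← LieSubmodule.baseChange_top, ← LieSubmodule.lie_baseChange]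
    exact Submodule.tmul_mem_baseChange_of_mem 1 hz
  have hn := isNilpotent_toEnd_of_mem_lie_solvable_of_isAlgClosed R (V := A ⊗[K] L) hz'
  rw [toEnd_baseChange] at hn
  have hinj : Function.Injective (End.baseChangeHom K A L) :=
    LinearMap.baseChangeHom_injective K L A
  rwa [← IsNilpotent.map_iff hinj]

-- `ad x` maps `L` into `N`, where it is nilpotent; the first application costs one extra power.
omit [CharZero K] [FiniteDimensional K L] in
theorem isNilpotent_ad_of_mem_nilpotent_lieIdeal (N : LieIdeal K L) (hN : LieRing.IsNilpotent N)
    {x : L} (hx : x ∈ N) : _root_.IsNilpotent (ad K L x) := by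
  obtain ⟨k, hk⟩ := isNilpotent_toEnd_of_isNilpotent K N N ⟨x, hx⟩
  have key : ∀ (n : ℕ) (y : N), (((ad K N ⟨x, hx⟩) ^ n) y : L) = ((ad K L x) ^ n) y := by
    intro n
    induction n with
    | zero => intro y; rfl
    | succ n ih => intro y; rw [pow_succ, pow_succ, Module.End.mul_apply, ih]; rfl
  refine ⟨k + 1, LinearMap.ext fun y ↦ ?_⟩
  have := key k ⟨⁅x, y⁆, lie_mem_left K L N x y hx⟩
  rw [pow_succ, Module.End.mul_apply, ad_apply, ← this]
  exact congrArg Subtype.val (LinearMap.congr_fun hk _)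

omit [CharZero K] in
/-- Adjoining to an ideal of ad-nilpotent elements one more ad-nilpotent element. -/
theorem isNilpotent_ad_of_mem_sup_span {I I' : LieIdeal K L}
    (hI : ∀ y ∈ I, _root_.IsNilpotent (ad K L y)) {x : L} (hx : _root_.IsNilpotent (ad K L x))
    (hI' : I'.toSubmodule = I.toSubmodule ⊔ K ∙ x) :
    ∀ y ∈ I', _root_.IsNilpotent (ad K L y) := by
  have hII' : I ≤ I' := by
    rw [← LieSubmodule.toSubmodule_le_toSubmodule, hI']
    exact le_sup_left
  have hxI' : x ∈ I' := by
    rw [← LieSubmodule.mem_toSubmodule, hI']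
    exact Submodule.mem_sup_right (Submodule.mem_span_singleton_self x)
  -- This is the inductive step of Engel's theorem: `I` acts nilpotently, and so does the one
  -- further generator `x`.
  have hnil : LieModule.IsNilpotent I' L := by
    refine LieSubmodule.isNilpotentOfIsNilpotentSpanSupEqTop (R := K) (I := I.comap I'.incl)
      (x := ⟨x, hxI'⟩) ?_ hx ?_
    · rw [eq_top_iff]
      rintro ⟨y, hy⟩ -
      rw [← LieSubmodule.mem_toSubmodule, hI', Submodule.mem_sup] at hy
      obtain ⟨i, hi, j, hj, rfl⟩ := hy
      obtain ⟨a, rfl⟩ := Submodule.mem_span_singleton.mp hj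
      refine Submodule.mem_sup.mpr ⟨a • ⟨x, hxI'⟩,
        Submodule.smul_mem _ _ (Submodule.mem_span_singleton_self _), ⟨i, hII' hi⟩, hi, ?_⟩
      ext
      exact add_comm _ _
    · rw [isNilpotent_iff_forall' (R := K)]
      rintro ⟨⟨y, hy⟩, hy'⟩
      exact hI y hy'
  rw [isNilpotent_iff_forall' (R := K)] at hnil
  exact fun y hy ↦ hnil ⟨y, hy⟩

/-- The maximal nilpotent ideal consists of the ad-nilpotent elements of the radical. -/
theorem mem_nilIdeal_iff {x : L} :
    x ∈ nilIdeal K L ↔ x ∈ radical K L ∧ _root_.IsNilpotent (ad K L x) := by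
  -- Every subspace between `[L, rad L]` and `rad L` is an ideal, so a maximal member of `P` absorbs
  -- single ad-nilpotent elements of the radical.
  let P : Set (LieIdeal K L) := {I | ⁅(⊤ : LieIdeal K L), radical K L⁆ ≤ I ∧ I ≤ radical K L ∧
    ∀ y ∈ I, _root_.IsNilpotent (ad K L y)}
  have hP : P.Nonempty := ⟨_, le_rfl, LieSubmodule.lie_le_right _ _, fun y hy ↦
    isNilpotent_ad_of_mem_lie_radical hy⟩
  obtain ⟨I, ⟨hI1, hI2, hI3⟩, hmax⟩ := (wellFounded_gt (α := LieIdeal K L)).has_min P hP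
  have hI4 : ∀ x ∈ radical K L, _root_.IsNilpotent (ad K L x) → x ∈ I := by
    intro x hx hxn
    let I' : LieIdeal K L :=
      { I.toSubmodule ⊔ K ∙ x with
        lie_mem := by
          intro y m hm
          obtain ⟨i, hi, j, hj, rfl⟩ := Submodule.mem_sup.mp hm
          obtain ⟨a, rfl⟩ := Submodule.mem_span_singleton.mp hj
          refine Submodule.mem_sup_left ?_
          rw [lie_add, lie_smul]
          exact I.add_mem (I.lie_mem hi)
            (I.smul_mem a (hI1 (LieSubmodule.lie_mem_lie (LieSubmodule.mem_top y) hx))) }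
    have hle : I ≤ I' := fun y hy ↦ Submodule.mem_sup_left hy
    have hI'P : I' ∈ P := by
      refine ⟨hI1.trans hle, fun y hy ↦ ?_, isNilpotent_ad_of_mem_sup_span hI3 hxn rfl⟩
      obtain ⟨i, hi, j, hj, rfl⟩ := Submodule.mem_sup.mp hy
      obtain ⟨a, rfl⟩ := Submodule.mem_span_singleton.mp hj
      exact (radical K L).add_mem (hI2 hi) ((radical K L).smul_mem a hx)
    have heq : I = I' := by
      by_contra h
      exact hmax I' hI'P (lt_of_le_of_ne hle h)
    rw [heq]
    exact Submodule.mem_sup_right (Submodule.mem_span_singleton_self x)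
  have hIeq : nilIdeal K L = I := by
    refine le_antisymm (sSup_le fun N hN y hy ↦ ?_) (le_sSup ?_)
    · have hN : LieRing.IsNilpotent N := hN
      exact hI4 y ((LieIdeal.solvable_iff_le_radical K L N).mp inferInstance hy)
        (isNilpotent_ad_of_mem_nilpotent_lieIdeal N hN hy)
    · change LieRing.IsNilpotent I
      rw [LieAlgebra.isNilpotent_iff_forall (R := K)]
      rintro ⟨y, hy⟩
      exact LieSubalgebra.isNilpotent_ad_of_isNilpotent_ad (I : LieSubalgebra K L) (x := ⟨y, hy⟩)
        (hI3 y hy)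
  rw [hIeq]
  exact ⟨fun hx ↦ ⟨hI2 hx, hI3 x hx⟩, fun hx ↦ hI4 x hx.1 hx.2⟩

theorem lie_mem_nilIdeal_of_mem_radical (x : L) {y : L} (hy : y ∈ radical K L) :
    ⁅x, y⁆ ∈ nilIdeal K L :=
  mem_nilIdeal_iff.mpr ⟨(radical K L).lie_mem hy, isNilpotent_ad_of_mem_lie_radical
    (LieSubmodule.lie_mem_lie (LieSubmodule.mem_top x) hy)⟩

end

/-- The quotient map by an ideal as a homomorphism of Lie algebras. -/
def quotHom {K L : Type*} [CommRing K] [LieRing L] [LieAlgebra K L] (I : LieIdeal K L) :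
    L →ₗ⁅K⁆ L ⧸ I :=
  { I.toSubmodule.mkQ with map_lie' := rfl }

theorem quotHom_surjective {K L : Type*} [CommRing K] [LieRing L] [LieAlgebra K L]
    (I : LieIdeal K L) : Function.Surjective (quotHom I) :=
  I.toSubmodule.mkQ_surjective

theorem quotHom_eq_zero_iff {K L : Type*} [CommRing K] [LieRing L] [LieAlgebra K L]
    (I : LieIdeal K L) {x : L} : quotHom I x = 0 ↔ x ∈ I :=
  Submodule.Quotient.mk_eq_zero I.toSubmodule

/-- The preimage of a solvable ideal is an extension of a solvable algebra by a solvable one, hence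
lies in the radical. -/
instance hasTrivialRadical_quotient_radical {K L : Type*} [Field K] [LieRing L]
    [LieAlgebra K L] [FiniteDimensional K L] : HasTrivialRadical K (L ⧸ radical K L) := by
  refine hasTrivialRadical_of_no_solvable_ideals fun I hI ↦ ?_
  obtain ⟨k, hk⟩ := IsSolvable.solvable K I
  rw [LieIdeal.derivedSeries_eq_bot_iff] at hk
  obtain ⟨l, hl⟩ := IsSolvable.solvable K (radical K L)
  rw [LieIdeal.derivedSeries_eq_bot_iff] at hl
  let p := quotHom (radical K L)
  have hD : ∀ n, derivedSeriesOfIdeal K L n (I.comap p) ≤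
      (derivedSeriesOfIdeal K _ n I).comap p := by
    intro n
    induction n with
    | zero => exact le_rfl
    | succ n ih =>
      rw [derivedSeriesOfIdeal_succ, derivedSeriesOfIdeal_succ]
      exact (LieSubmodule.mono_lie ih ih).trans (LieIdeal.comap_bracket_le p)
  have hle : derivedSeriesOfIdeal K L k (I.comap p) ≤ radical K L := by
    intro x hx
    have := hD k hx
    rw [hk, LieIdeal.mem_comap, LieSubmodule.mem_bot] at this
    exact (quotHom_eq_zero_iff _).mp this
  have hsol : IsSolvable (I.comap p) := by
    refine IsSolvable.mk (R := K) (k := l + k) ?_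
    rw [LieIdeal.derivedSeries_eq_bot_iff, derivedSeriesOfIdeal_add, eq_bot_iff, ← hl]
    exact derivedSeriesOfIdeal_mono hle l
  have hrad := (LieIdeal.solvable_iff_le_radical K L _).mp hsol
  rw [LieSubmodule.eq_bot_iff]
  intro y hy
  obtain ⟨x, rfl⟩ := quotHom_surjective _ y
  exact (quotHom_eq_zero_iff _).mpr (hrad hy)

end Radicals

/-! ### Homogeneous subspaces, degree zero parts and scaling automorphisms. -/

section Gradings

open LieAlgebra LieModule Module

attribute [local instance 100] LieRing.ofAssociativeRing

section

variable {K L : Type*} [Field K] [LieRing L] [LieAlgebra K L]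
  (𝒢 : ℤ → Submodule K L) [GradedLieAlgebra 𝒢]

/-- The projection to the component of degree `p`. -/
noncomputable def gradeProj (p : ℤ) : L →ₗ[K] L :=
  (𝒢 p).subtype ∘ₗ DirectSum.component K ℤ (fun i ↦ 𝒢 i) p ∘ₗ
    (DirectSum.decomposeLinearEquiv 𝒢).toLinearMap

/-- The linear map given on the component of degree `p` by `f p`. -/
noncomputable def ofGradedPieces (f : ∀ p, 𝒢 p →ₗ[K] L) : L →ₗ[K] L :=
  DirectSum.toModule K ℤ L f ∘ₗ (DirectSum.decomposeLinearEquiv 𝒢).toLinearMap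

theorem gradeProj_mem (p : ℤ) (x : L) : gradeProj 𝒢 p x ∈ 𝒢 p :=
  (DirectSum.decompose 𝒢 x p).2

variable {𝒢}

theorem gradeProj_of_mem {p : ℤ} {x : L} (hx : x ∈ 𝒢 p) : gradeProj 𝒢 p x = x :=
  DirectSum.decompose_of_mem_same 𝒢 hx

theorem gradeProj_of_mem_ne {p q : ℤ} {x : L} (hx : x ∈ 𝒢 p) (h : p ≠ q) :
    gradeProj 𝒢 q x = 0 :=
  DirectSum.decompose_of_mem_ne 𝒢 hx h

theorem ofGradedPieces_of_mem (f : ∀ p, 𝒢 p →ₗ[K] L) {p : ℤ} {x : L} (hx : x ∈ 𝒢 p) :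
    ofGradedPieces 𝒢 f x = f p ⟨x, hx⟩ := by
  simp [ofGradedPieces, DirectSum.decomposeLinearEquiv_apply, DirectSum.decompose_of_mem 𝒢 hx,
    ← DirectSum.lof_eq_of K]

theorem isHomogeneous_iff_gradeProj_mem {N : Submodule K L} :
    N.IsHomogeneous 𝒢 ↔ ∀ p, ∀ x ∈ N, gradeProj 𝒢 p x ∈ N :=
  ⟨fun h p _ hx ↦ h p hx, fun h p _ hx ↦ h p _ hx⟩

/-- To show that a linear map takes a homogeneous subspace into `W`, it suffices to consider
homogeneous elements. -/
theorem map_mem_of_homogeneous {M : Type*} [AddCommGroup M] [Module K M] {N : Submodule K L}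
    (hN : N.IsHomogeneous 𝒢) {W : Submodule K M} (g : L →ₗ[K] M)
    (h : ∀ p, ∀ x ∈ N, x ∈ 𝒢 p → g x ∈ W) : ∀ x ∈ N, g x ∈ W := by
  classical
  intro x hx
  rw [← DirectSum.sum_support_decompose 𝒢 x, map_sum]
  exact W.sum_mem fun p _ ↦ h p _ (isHomogeneous_iff_gradeProj_mem.mp hN p x hx)
    (gradeProj_mem 𝒢 p x)

theorem isHomogeneous_top : (⊤ : Submodule K L).IsHomogeneous 𝒢 :=
  isHomogeneous_iff_gradeProj_mem.mpr fun _ _ _ ↦ trivial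

theorem eq_of_homogeneous {M : Type*} [AddCommGroup M] [Module K M] {g g' : L →ₗ[K] M}
    (h : ∀ p, ∀ x ∈ 𝒢 p, g x = g' x) : g = g' := by
  ext x
  have := map_mem_of_homogeneous (𝒢 := 𝒢) isHomogeneous_top (W := ⊥) (g - g')
    (fun p x _ hx ↦ by simp [h p x hx]) x trivial
  simpa [sub_eq_zero] using this

theorem isHomogeneous_inf {N N' : Submodule K L} (hN : N.IsHomogeneous 𝒢)
    (hN' : N'.IsHomogeneous 𝒢) : (N ⊓ N').IsHomogeneous 𝒢 := by
  rw [isHomogeneous_iff_gradeProj_mem] at *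
  exact fun p x hx ↦ ⟨hN p x hx.1, hN' p x hx.2⟩

theorem isHomogeneous_sup {N N' : Submodule K L} (hN : N.IsHomogeneous 𝒢)
    (hN' : N'.IsHomogeneous 𝒢) : (N ⊔ N').IsHomogeneous 𝒢 := by
  rw [isHomogeneous_iff_gradeProj_mem] at *
  intro p x hx
  obtain ⟨y, hy, z, hz, rfl⟩ := Submodule.mem_sup.mp hx
  rw [map_add]
  exact Submodule.add_mem_sup (hN p y hy) (hN' p z hz)

theorem isHomogeneous_of_le {N : Submodule K L} {p : ℤ} (hN : N ≤ 𝒢 p) :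
    N.IsHomogeneous 𝒢 := by
  rw [isHomogeneous_iff_gradeProj_mem]
  intro q x hx
  by_cases h : p = q
  · rw [← h, gradeProj_of_mem (hN hx)]
    exact hx
  · rw [gradeProj_of_mem_ne (hN hx) h]
    exact N.zero_mem

theorem lie_mem_grade {p q : ℤ} {x y : L} (hx : x ∈ 𝒢 p) (hy : y ∈ 𝒢 q) : ⁅x, y⁆ ∈ 𝒢 (p + q) :=
  SetLike.GradedBracket.bracket_mem hx hy

theorem gradeProj_lie_left {i : ℤ} {x : L} (hx : x ∈ 𝒢 i) (j : ℤ) (z : L) :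
    gradeProj 𝒢 (i + j) ⁅x, z⁆ = ⁅x, gradeProj 𝒢 j z⁆ := by
  have : gradeProj 𝒢 (i + j) ∘ₗ (ad K L x : L →ₗ[K] L) =
      (ad K L x : L →ₗ[K] L) ∘ₗ gradeProj 𝒢 j := by
    refine eq_of_homogeneous (𝒢 := 𝒢) fun k z hz ↦ ?_
    simp only [LinearMap.comp_apply, ad_apply]
    by_cases h : k = j
    · rw [← h, gradeProj_of_mem (lie_mem_grade hx hz), gradeProj_of_mem hz]
    · rw [gradeProj_of_mem_ne (lie_mem_grade hx hz) (fun h' ↦ h (add_left_cancel h')),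
        gradeProj_of_mem_ne hz h, lie_zero]
  exact LinearMap.congr_fun this z

theorem gradeProj_lie_right {j : ℤ} {y : L} (hy : y ∈ 𝒢 j) (i : ℤ) (z : L) :
    gradeProj 𝒢 (i + j) ⁅z, y⁆ = ⁅gradeProj 𝒢 i z, y⁆ := by
  rw [← lie_skew z y, map_neg, add_comm, gradeProj_lie_left hy, lie_skew]

/-- The degree zero part of an endomorphism. -/
noncomputable def degreeZeroPart (𝒢 : ℤ → Submodule K L) [GradedLieAlgebra 𝒢]
    (f : L →ₗ[K] L) : L →ₗ[K] L :=
  ofGradedPieces 𝒢 fun p ↦ gradeProj 𝒢 p ∘ₗ f ∘ₗ (𝒢 p).subtype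

theorem degreeZeroPart_of_mem (f : L →ₗ[K] L) {p : ℤ} {x : L} (hx : x ∈ 𝒢 p) :
    degreeZeroPart 𝒢 f x = gradeProj 𝒢 p (f x) :=
  ofGradedPieces_of_mem _ hx

theorem degreeZeroPart_gradeProj (f : L →ₗ[K] L) (q : ℤ) (x : L) :
    degreeZeroPart 𝒢 f (gradeProj 𝒢 q x) = gradeProj 𝒢 q (degreeZeroPart 𝒢 f x) := by
  have : degreeZeroPart 𝒢 f ∘ₗ gradeProj 𝒢 q = gradeProj 𝒢 q ∘ₗ degreeZeroPart 𝒢 f := by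
    refine eq_of_homogeneous (𝒢 := 𝒢) fun p x hx ↦ ?_
    simp only [LinearMap.comp_apply, degreeZeroPart_of_mem f hx]
    by_cases h : p = q
    · rw [← h, gradeProj_of_mem hx, degreeZeroPart_of_mem f hx,
        gradeProj_of_mem (gradeProj_mem 𝒢 p _)]
    · rw [gradeProj_of_mem_ne hx h, map_zero, gradeProj_of_mem_ne (gradeProj_mem 𝒢 p _) h]
  exact LinearMap.congr_fun this x

/-- The homomorphism multiplying degree `p` by `a ^ p`. -/
noncomputable def gradeScale (𝒢 : ℤ → Submodule K L) [GradedLieAlgebra 𝒢] (a : K) (ha : a ≠ 0) :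
    L →ₗ⁅K⁆ L :=
  { ofGradedPieces 𝒢 fun p ↦ a ^ p • (𝒢 p).subtype with
    map_lie' := by
      intro x y
      have hs : ∀ p, ∀ x ∈ 𝒢 p, ofGradedPieces 𝒢 (fun p ↦ a ^ p • (𝒢 p).subtype) x =
        a ^ p • x := fun p x hx ↦ by simp [ofGradedPieces_of_mem _ hx]
      set s := ofGradedPieces 𝒢 fun p ↦ a ^ p • (𝒢 p).subtype
      change s ⁅x, y⁆ = ⁅s x, s y⁆
      have h1 : ∀ p, ∀ x ∈ 𝒢 p, s ∘ₗ (ad K L x : L →ₗ[K] L) = (ad K L (s x) : L →ₗ[K] L) ∘ₗ s := by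
        intro p x hx
        refine eq_of_homogeneous (𝒢 := 𝒢) fun q y hy ↦ ?_
        simp only [LinearMap.comp_apply, ad_apply, hs p x hx, hs q y hy,
          hs _ _ (lie_mem_grade hx hy), smul_lie, lie_smul, smul_smul]
        rw [zpow_add₀ ha, mul_comm]
      have h2 : s ∘ₗ (ad K L : L →ₗ[K] End K L).flip y =
          (ad K L : L →ₗ[K] End K L).flip (s y) ∘ₗ s :=
        eq_of_homogeneous (𝒢 := 𝒢) fun p x hx ↦ LinearMap.congr_fun (h1 p x hx) y
      exact LinearMap.congr_fun h2 x }

theorem gradeScale_of_mem (a : K) (ha : a ≠ 0) {p : ℤ} {x : L} (hx : x ∈ 𝒢 p) :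
    gradeScale 𝒢 a ha x = a ^ p • x := by
  change ofGradedPieces 𝒢 (fun p ↦ a ^ p • (𝒢 p).subtype) x = _
  simp [ofGradedPieces_of_mem _ hx]

theorem gradeScale_inv_gradeScale (a : K) (ha : a ≠ 0) (x : L) :
    gradeScale 𝒢 a⁻¹ (inv_ne_zero ha) (gradeScale 𝒢 a ha x) = x := by
  have : (gradeScale 𝒢 a⁻¹ (inv_ne_zero ha) : L →ₗ[K] L) ∘ₗ (gradeScale 𝒢 a ha : L →ₗ[K] L) =
      LinearMap.id := by
    refine eq_of_homogeneous (𝒢 := 𝒢) fun p x hx ↦ ?_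
    have h1 := gradeScale_of_mem a ha hx
    have h2 := gradeScale_of_mem a⁻¹ (inv_ne_zero ha) hx
    simp [h1, h2, smul_smul, mul_inv_cancel₀ (zpow_ne_zero p ha)]
  exact LinearMap.congr_fun this x

/-- The eigenvalues `2 ^ p` are distinct in characteristic `0`. The polynomial `Q` in the scaling
map kills all components of `x` except that of degree `p`. -/
theorem isHomogeneous_of_gradeScale_mem [CharZero K] {N : Submodule K L}
    (hN : ∀ x ∈ N, gradeScale 𝒢 (2 : K) two_ne_zero x ∈ N) : N.IsHomogeneous 𝒢 := by
  classical
  rw [isHomogeneous_iff_gradeProj_mem]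
  intro p x hx
  let f : End K L := (gradeScale 𝒢 (2 : K) two_ne_zero : L →ₗ[K] L)
  set S := (DirectSum.decompose 𝒢 x).support
  let Q : Polynomial K := ∏ q ∈ S.erase p, (Polynomial.X - Polynomial.C ((2 : K) ^ q))
  have h1 : Polynomial.aeval f Q x ∈ N := Polynomial.aeval_apply_smul_mem_of_le_comap hx Q f hN
  have h2 : Polynomial.aeval f Q x = Q.eval ((2 : K) ^ p) • gradeProj 𝒢 p x := by
    have hq : ∀ q, Polynomial.aeval f Q (gradeProj 𝒢 q x) =
        Q.eval ((2 : K) ^ q) • gradeProj 𝒢 q x := fun q ↦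
      Module.End.aeval_apply_of_mem_apply_eq_smul (gradeScale_of_mem _ _ (gradeProj_mem 𝒢 q x))
    conv_lhs => rw [← DirectSum.sum_support_decompose 𝒢 x, map_sum]
    rw [Finset.sum_eq_single p]
    · exact hq p
    · intro q hqS hqp
      have : Q.eval ((2 : K) ^ q) = 0 := by
        rw [Polynomial.eval_prod]
        exact Finset.prod_eq_zero (Finset.mem_erase.mpr ⟨hqp, hqS⟩) (by simp)
      have h := hq q
      rw [this, zero_smul] at h
      exact h
    · intro hp
      rw [DFinsupp.notMem_support_iff.mp hp]
      simp
  have h3 : Q.eval ((2 : K) ^ p) ≠ 0 := by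
    rw [Polynomial.eval_prod, Finset.prod_ne_zero_iff]
    intro q hq h
    rw [Polynomial.eval_sub, Polynomial.eval_X, Polynomial.eval_C, sub_eq_zero] at h
    have h' : ((2 : ℚ) ^ p : ℚ) = 2 ^ q := by
      have : (((2 : ℚ) ^ p : ℚ) : K) = ((2 ^ q : ℚ) : K) := by push_cast; exact h
      exact Rat.cast_injective this
    exact (Finset.mem_erase.mp hq).1 (zpow_right_injective₀ (by norm_num) (by norm_num) h').symm
  rw [h2] at h1
  exact (N.smul_mem_iff h3).mp h1

variable (𝒢) in
/-- The radical of a graded Lie algebra is graded. -/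
theorem isHomogeneous_radical [CharZero K] [FiniteDimensional K L] :
    (radical K L).toSubmodule.IsHomogeneous 𝒢 := by
  refine isHomogeneous_of_gradeScale_mem fun x hx ↦ ?_
  let φ := gradeScale 𝒢 (2 : K) two_ne_zero
  let ψ := gradeScale 𝒢 (2 : K)⁻¹ (inv_ne_zero two_ne_zero)
  have hψφ : ∀ y, ψ (φ y) = y := gradeScale_inv_gradeScale _ _
  have hφψ : ∀ y, φ (ψ y) = y := fun y ↦ by
    have := gradeScale_inv_gradeScale (𝒢 := 𝒢) (2 : K)⁻¹ (inv_ne_zero two_ne_zero) y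
    simpa only [inv_inv] using this
  -- The radical is stable under automorphisms: its preimage under the inverse scaling is a solvable
  -- ideal.
  let I : LieIdeal K L := (radical K L).comap ψ
  let g : I →ₗ⁅K⁆ radical K L :=
    { toFun := fun y ↦ ⟨ψ y, y.2⟩
      map_add' := fun y z ↦ Subtype.ext (map_add ψ _ _)
      map_smul' := fun a y ↦ Subtype.ext (map_smul ψ _ _)
      map_lie' := fun {y z} ↦ Subtype.ext (LieHom.map_lie ψ _ _) }
  have hg : Function.Injective g := fun y z h ↦ by
    have := congrArg φ (congrArg Subtype.val h)
    exact Subtype.ext (by simpa only [g, LieHom.coe_mk, hφψ] using this)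
  have hI : IsSolvable I := hg.lieAlgebra_isSolvable
  have hle := (LieIdeal.solvable_iff_le_radical K L I).mp hI
  refine hle ?_
  change ψ (φ x) ∈ radical K L
  rw [hψφ]
  exact hx

end

end Gradings

/-! ### The graded Levi decomposition. -/

section GradedLevi

open LieAlgebra LieModule Module

attribute [local instance 100] LieRing.ofAssociativeRing

/-- The homomorphism induced on the quotient by an ideal contained in the kernel. -/
def quotLift {K L S : Type*} [CommRing K] [LieRing L] [LieAlgebra K L] [LieRing S]
    [LieAlgebra K S] (I : LieIdeal K L) (f : L →ₗ⁅K⁆ S) (h : ∀ x ∈ I, f x = 0) :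
    L ⧸ I →ₗ⁅K⁆ S :=
  { I.toSubmodule.liftQ (f : L →ₗ[K] S) h with
    map_lie' := by
      intro x y
      obtain ⟨x, rfl⟩ := quotHom_surjective I x
      obtain ⟨y, rfl⟩ := quotHom_surjective I y
      exact f.map_lie x y }

theorem quotLift_quotHom {K L S : Type*} [CommRing K] [LieRing L] [LieAlgebra K L] [LieRing S]
    [LieAlgebra K S] (I : LieIdeal K L) (f : L →ₗ⁅K⁆ S) (h : ∀ x ∈ I, f x = 0) (x : L) :
    quotLift I f h (quotHom I x) = f x := rfl

theorem eq_bot_of_lie_self_eq_of_isSolvable {K L : Type*} [CommRing K] [LieRing L]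
    [LieAlgebra K L] (I : LieIdeal K L) [hI : LieAlgebra.IsSolvable I] (h : ⁅I, I⁆ = I) : I = ⊥ := by
  obtain ⟨k, hk⟩ := IsSolvable.solvable K I
  rw [LieIdeal.derivedSeries_eq_bot_iff] at hk
  have : ∀ n, derivedSeriesOfIdeal K L n I = I := by
    intro n
    induction n with
    | zero => rfl
    | succ n ih => rw [derivedSeriesOfIdeal_succ, ih, h]
  rw [← this k, hk]

/-- For a homomorphism onto a semisimple Lie algebra with kernel `B`, there is a projection onto `B`
that is a derivation modulo `[B, B]`. -/
theorem exists_projection_derivation_mod_lie {K G S : Type*} [Field K] [CharZero K] [LieRing G]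
    [LieAlgebra K G] [FiniteDimensional K G] [LieRing S] [LieAlgebra K S]
    [FiniteDimensional K S] [HasTrivialRadical K S] (p : G →ₗ⁅K⁆ S)
    (hp : Function.Surjective p) :
    ∃ f : G →ₗ[K] G, (∀ x, p (f x) = 0) ∧ (∀ x, p x = 0 → f x - x ∈ ⁅p.ker, p.ker⁆) ∧
      ∀ x y, f ⁅x, y⁆ - (⁅x, f y⁆ + ⁅f x, y⁆) ∈ ⁅p.ker, p.ker⁆ := by
  set C : LieIdeal K G := ⁅p.ker, p.ker⁆
  have hC : ∀ x ∈ C, p x = 0 := fun x hx ↦ LieSubmodule.lie_le_left p.ker p.ker hx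
  let q := quotLift C p hC
  have hq : Function.Surjective q := fun y ↦ by
    obtain ⟨x, rfl⟩ := hp y
    exact ⟨quotHom C x, rfl⟩
  have hab : ∀ a b : G ⧸ C, q a = 0 → q b = 0 → ⁅a, b⁆ = 0 := by
    intro a b ha hb
    obtain ⟨a, rfl⟩ := quotHom_surjective C a
    obtain ⟨b, rfl⟩ := quotHom_surjective C b
    rw [← LieHom.map_lie, quotHom_eq_zero_iff]
    exact LieSubmodule.lie_mem_lie ha hb
  obtain ⟨σ, hσ⟩ := exists_lieHom_section_of_abelian_ker q hq hab
  obtain ⟨f, hf⟩ := Module.projective_lifting_property (quotHom C : G →ₗ[K] G ⧸ C)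
    ((LinearMap.id - (σ : S →ₗ[K] G ⧸ C) ∘ₗ (q : G ⧸ C →ₗ[K] S)) ∘ₗ (quotHom C : G →ₗ[K] G ⧸ C))
    (quotHom_surjective C)
  have hf' : ∀ x, quotHom C (f x) = quotHom C x - σ (p x) := fun x ↦ LinearMap.congr_fun hf x
  have hpf : ∀ x, p (f x) = 0 := fun x ↦ by
    rw [← quotLift_quotHom C p hC, hf', map_sub, quotLift_quotHom]
    exact sub_eq_zero.mpr (hσ _).symm
  refine ⟨f, hpf, fun x hx ↦ ?_, fun x y ↦ ?_⟩
  · rw [← quotHom_eq_zero_iff, map_sub, hf', hx, map_zero, sub_zero, sub_self]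
  · rw [← quotHom_eq_zero_iff]
    -- Modulo `C`, `f` is `id - σ ∘ p` with image in the abelian kernel; expanding `[f x, f y] = 0`
    -- gives the derivation rule.
    have h0 := hab (quotHom C (f x)) (quotHom C (f y)) (hpf x) (hpf y)
    rw [hf', hf', lie_sub, sub_lie, sub_lie] at h0
    rw [map_sub, map_add, LieHom.map_lie, LieHom.map_lie, hf', hf', hf', LieHom.map_lie,
      LieHom.map_lie, LieHom.map_lie, lie_sub, sub_lie]
    linear_combination (norm := module) -h0

variable {K L : Type*} [Field K] [CharZero K] [LieRing L] [LieAlgebra K L]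
  [FiniteDimensional K L] {𝒢 : ℤ → Submodule K L} [GradedLieAlgebra 𝒢]

omit [CharZero K] [FiniteDimensional K L] in
/-- The span of the brackets of homogeneous subspaces is homogeneous. -/
theorem isHomogeneous_span_lie {A B : Submodule K L} (hA : A.IsHomogeneous 𝒢)
    (hB : B.IsHomogeneous 𝒢) :
    (Submodule.span K {z | ∃ a ∈ A, ∃ b ∈ B, ⁅a, b⁆ = z}).IsHomogeneous 𝒢 := by
  rw [isHomogeneous_iff_gradeProj_mem]
  intro q z hz
  set W := Submodule.span K {z | ∃ a ∈ A, ∃ b ∈ B, ⁅a, b⁆ = z}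
  induction hz using Submodule.span_induction with
  | zero => simp
  | add x y _ _ hx hy => rw [map_add]; exact W.add_mem hx hy
  | smul c x _ hx => rw [map_smul]; exact W.smul_mem c hx
  | mem z hz =>
    obtain ⟨a, ha, b, hb, rfl⟩ := hz
    refine map_mem_of_homogeneous hA (W := W)
      (gradeProj 𝒢 q ∘ₗ (ad K L : L →ₗ[K] End K L).flip b) (fun i x hx hxi ↦ ?_) a ha
    refine map_mem_of_homogeneous hB (W := W)
      (gradeProj 𝒢 q ∘ₗ (ad K L x : L →ₗ[K] L)) (fun j y hy hyj ↦ ?_) b hb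
    change gradeProj 𝒢 q ⁅x, y⁆ ∈ W
    by_cases h : i + j = q
    · rw [← h, gradeProj_of_mem (lie_mem_grade hxi hyj)]
      exact Submodule.subset_span ⟨x, hx, y, hy, rfl⟩
    · rw [gradeProj_of_mem_ne (lie_mem_grade hxi hyj) h]
      exact W.zero_mem

/-- One step of the construction of a graded Levi subalgebra: the kernel can be made smaller by
passing to a graded subalgebra that still surjects. -/
theorem exists_homogeneous_subalgebra_lt {S : Type*} [LieRing S] [LieAlgebra K S]
    [FiniteDimensional K S] [HasTrivialRadical K S] (p : L →ₗ⁅K⁆ S)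
    [hsol : LieAlgebra.IsSolvable p.ker] (hker : p.ker.toSubmodule.IsHomogeneous 𝒢)
    (l : LieSubalgebra K L) (hl : l.toSubmodule.IsHomogeneous 𝒢) (hpl : ∀ y, ∃ x ∈ l, p x = y)
    (hne : ∃ x ∈ l, p x = 0 ∧ x ≠ 0) :
    ∃ l' < l, l'.toSubmodule.IsHomogeneous 𝒢 ∧ ∀ y, ∃ x ∈ l', p x = y := by
  let pl : l →ₗ⁅K⁆ S := p.comp l.incl
  have hpl' : Function.Surjective pl := fun y ↦ by
    obtain ⟨x, hx, rfl⟩ := hpl y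
    exact ⟨⟨x, hx⟩, rfl⟩
  obtain ⟨f, hf1, hf2, hf3⟩ := exists_projection_derivation_mod_lie pl hpl'
  set B : LieIdeal K l := pl.ker
  set C : LieIdeal K l := ⁅B, B⁆ with hC
  -- A nonzero solvable ideal differs from its derived ideal; this makes the step strictly
  -- decreasing.
  have hBC : B ≠ C := by
    intro h
    let g : B →ₗ⁅K⁆ p.ker :=
      { toFun := fun y ↦ ⟨(y : l), y.2⟩
        map_add' := fun y z ↦ rfl
        map_smul' := fun a y ↦ rfl
        map_lie' := fun {y z} ↦ rfl }
    have hg : Function.Injective g := fun y z h ↦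
      Subtype.ext (Subtype.ext (congrArg (fun w : p.ker ↦ (w : L)) h))
    have hB : IsSolvable B := hg.lieAlgebra_isSolvable
    have := eq_bot_of_lie_self_eq_of_isSolvable B h.symm
    obtain ⟨x, hx, hpx, hx0⟩ := hne
    have hxB : (⟨x, hx⟩ : l) ∈ B := hpx
    rw [this, LieSubmodule.mem_bot] at hxB
    exact hx0 (congrArg Subtype.val hxB)
  let A : Submodule K L := l.toSubmodule ⊓ p.ker.toSubmodule
  let A' : Submodule K L := C.toSubmodule.map l.toSubmodule.subtype
  have hA : A.IsHomogeneous 𝒢 := isHomogeneous_inf hl hker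
  have hA'eq : A' = Submodule.span K {z | ∃ a ∈ A, ∃ b ∈ A, ⁅a, b⁆ = z} := by
    simp only [A', hC]
    rw [LieSubmodule.lieIdeal_oper_eq_linear_span', Submodule.map_span]
    congr 1
    ext z
    constructor
    · rintro ⟨_, ⟨a, ha, b, hb, rfl⟩, rfl⟩
      exact ⟨a, ⟨a.2, ha⟩, b, ⟨b.2, hb⟩, rfl⟩
    · rintro ⟨a, ⟨ha, ha'⟩, b, ⟨hb, hb'⟩, rfl⟩
      exact ⟨⁅(⟨a, ha⟩ : l), (⟨b, hb⟩ : l)⁆, ⟨⟨a, ha⟩, ha', ⟨b, hb⟩, hb', rfl⟩, rfl⟩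
  have hA' : A'.IsHomogeneous 𝒢 := hA'eq ▸ isHomogeneous_span_lie hA hA
  have hA'A : A' ≤ A := by
    rintro _ ⟨c, hc, rfl⟩
    exact ⟨c.2, LieSubmodule.lie_le_left B B hc⟩
  have hA'lie : ∀ x ∈ l, ∀ a ∈ A', ⁅x, a⁆ ∈ A' := by
    rintro x hx _ ⟨c, hc, rfl⟩
    exact ⟨⁅(⟨x, hx⟩ : l), c⁆, C.lie_mem hc, rfl⟩
  -- `g` merely extends `f` to all of `L`, so that its degree zero part makes sense; only values on
  -- `l` are used.
  obtain ⟨g, hg⟩ := LinearMap.exists_leftInverse_of_injective l.toSubmodule.subtype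
    l.toSubmodule.ker_subtype
  have hg' : ∀ v (hv : v ∈ l), g v = ⟨v, hv⟩ := fun v hv ↦ LinearMap.congr_fun hg ⟨v, hv⟩
  let F : L →ₗ[K] L := l.toSubmodule.subtype ∘ₗ f ∘ₗ g
  have hF : ∀ x (hx : x ∈ l), F x = f ⟨x, hx⟩ := fun x hx ↦ by
    change ((f (g x) : l) : L) = _
    rw [hg' x hx]
  -- As `l`, `A` and `A'` are graded, the three properties of `f` can be checked on homogeneous
  -- elements, where they pass to `f₀`.
  let f₀ := degreeZeroPart 𝒢 F
  have hf₀A : ∀ x ∈ l, f₀ x ∈ A := by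
    refine map_mem_of_homogeneous hl f₀ fun q x hx hxq ↦ ?_
    simp only [f₀, degreeZeroPart_of_mem F hxq]
    refine isHomogeneous_iff_gradeProj_mem.mp hA q _ ?_
    rw [hF x hx]
    exact ⟨(f ⟨x, hx⟩).2, hf1 _⟩
  have hf₀id : ∀ x ∈ A, f₀ x - x ∈ A' := by
    refine map_mem_of_homogeneous hA (f₀ - LinearMap.id) fun q x hx hxq ↦ ?_
    simp only [f₀, LinearMap.sub_apply, degreeZeroPart_of_mem F hxq, LinearMap.id_apply]
    have := isHomogeneous_iff_gradeProj_mem.mp hA' q (F x - x)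
      (by rw [hF x hx.1]; exact ⟨_, hf2 ⟨x, hx.1⟩ hx.2, rfl⟩)
    rwa [map_sub, gradeProj_of_mem hxq] at this
  have hf₀lie : ∀ y ∈ l, ∀ x ∈ l, f₀ ⁅x, y⁆ - (⁅x, f₀ y⁆ + ⁅f₀ x, y⁆) ∈ A' := by
    intro y hy
    refine map_mem_of_homogeneous hl (W := A')
      (f₀ ∘ₗ (ad K L : L →ₗ[K] End K L).flip y - ((ad K L : L →ₗ[K] End K L).flip (f₀ y) +
        (ad K L : L →ₗ[K] End K L).flip y ∘ₗ f₀)) fun i x hx hxi ↦ ?_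
    refine map_mem_of_homogeneous hl (W := A')
      (f₀ ∘ₗ (ad K L x : L →ₗ[K] L) - ((ad K L x : L →ₗ[K] L) ∘ₗ f₀ +
        (ad K L (f₀ x) : L →ₗ[K] L))) (fun j y hy hyj ↦ ?_) y hy
    change f₀ ⁅x, y⁆ - (⁅x, f₀ y⁆ + ⁅f₀ x, y⁆) ∈ A'
    have hxl : x ∈ l := hx
    have hyl : y ∈ l := hy
    have h1 := hf3 ⟨x, hxl⟩ ⟨y, hyl⟩
    have h2 : F ⁅x, y⁆ - (⁅x, F y⁆ + ⁅F x, y⁆) ∈ A' := by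
      rw [hF x hxl, hF y hyl, hF _ (l.lie_mem hxl hyl)]
      exact ⟨_, h1, rfl⟩
    have h3 := isHomogeneous_iff_gradeProj_mem.mp hA' (i + j) _ h2
    simp only [f₀]
    rw [degreeZeroPart_of_mem F hxi, degreeZeroPart_of_mem F hyj,
      degreeZeroPart_of_mem F (lie_mem_grade hxi hyj), ← gradeProj_lie_left hxi,
      ← gradeProj_lie_right hyj, ← map_add, ← map_sub]
    exact h3
  -- The kernel of a derivation modulo `A'` is a subalgebra. It still surjects, because `x - f₀ x`
  -- lies in it and has the same image as `x`.
  let l' : LieSubalgebra K L :=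
    { l.toSubmodule ⊓ A'.comap f₀ with
      lie_mem' := by
        intro x y hxl hyl
        obtain ⟨hx, hx'⟩ := hxl
        obtain ⟨hy, hy'⟩ := hyl
        refine ⟨l.lie_mem hx hy, ?_⟩
        have h1 := hf₀lie y hy x hx
        have h2 := hA'lie x hx _ hy'
        have h3 := hA'lie y hy _ hx'
        rw [← lie_skew] at h3
        have := A'.add_mem h1 (A'.add_mem h2 (A'.neg_mem h3))
        rw [neg_neg, sub_add_cancel] at this
        exact this }
  have hle : l' ≤ l := fun x hx ↦ hx.1
  have hne' : l' ≠ l := by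
    intro h
    refine hBC (le_antisymm ?_ (LieSubmodule.lie_le_left B B))
    intro b hb
    have h1 := hf₀id b ⟨b.2, hb⟩
    have h2 : (b : L) ∈ l' := by rw [h]; exact b.2
    have h3 := A'.sub_mem h2.2 h1
    rw [sub_sub_cancel] at h3
    obtain ⟨c, hc, hcb⟩ := h3
    rwa [← Subtype.ext hcb]
  refine ⟨l', lt_of_le_of_ne hle hne', ?_, fun y ↦ ?_⟩
  · rw [isHomogeneous_iff_gradeProj_mem]
    rintro q x ⟨hx, hx'⟩
    refine ⟨isHomogeneous_iff_gradeProj_mem.mp hl q x hx, ?_⟩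
    change f₀ (gradeProj 𝒢 q x) ∈ A'
    rw [degreeZeroPart_gradeProj]
    exact isHomogeneous_iff_gradeProj_mem.mp hA' q _ hx'
  · obtain ⟨x, hx, rfl⟩ := hpl y
    have h1 := hf₀A x hx
    refine ⟨x - f₀ x, ⟨l.sub_mem hx h1.1, ?_⟩, ?_⟩
    · change f₀ (x - f₀ x) ∈ A'
      rw [map_sub, ← neg_sub]
      exact A'.neg_mem (hf₀id _ h1)
    · have : p (f₀ x) = 0 := h1.2
      rw [map_sub, this, sub_zero]

/-- Graded Levi decomposition. -/
theorem exists_homogeneous_levi {S : Type*} [LieRing S] [LieAlgebra K S]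
    [FiniteDimensional K S] [HasTrivialRadical K S] (p : L →ₗ⁅K⁆ S)
    [LieAlgebra.IsSolvable p.ker] (hker : p.ker.toSubmodule.IsHomogeneous 𝒢)
    (c : LieSubalgebra K L) (hc : c.toSubmodule.IsHomogeneous 𝒢) (hpc : ∀ y, ∃ x ∈ c, p x = y) :
    ∃ l ≤ c, l.toSubmodule.IsHomogeneous 𝒢 ∧ (∀ y, ∃ x ∈ l, p x = y) ∧
      ∀ x ∈ l, p x = 0 → x = 0 := by
  obtain ⟨l, ⟨h1, h2, h3⟩, hmin⟩ :=
    (measure fun l : LieSubalgebra K L ↦ finrank K l.toSubmodule).wf.has_min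
      {l | l ≤ c ∧ l.toSubmodule.IsHomogeneous 𝒢 ∧ ∀ y, ∃ x ∈ l, p x = y} ⟨c, le_rfl, hc, hpc⟩
  refine ⟨l, h1, h2, h3, ?_⟩
  by_contra! hne
  obtain ⟨l', hlt, h2', h3'⟩ := exists_homogeneous_subalgebra_lt p hker l h2 h3 hne
  exact hmin l' ⟨hlt.le.trans h1, h2', h3'⟩ (Submodule.finrank_lt_finrank_of_lt hlt)

end GradedLevi

/-! ### Tori in the radical, their centralizers, and reductivity. -/

section ReductiveLeviFactor

open LieAlgebra LieModule Module

attribute [local instance 100] LieRing.ofAssociativeRing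

/-- A polynomial summand `S` of `A` with `A - S` nilpotent maps into `W` what `A` maps into `W`. -/
theorem apply_mem_of_isNilpotent_sub {K V : Type*} [Field K] [AddCommGroup V] [Module K V]
    {A S : End K V} (hS : S ∈ Algebra.adjoin K {A}) (hN : _root_.IsNilpotent (A - S))
    {W : Submodule K V} (hW : ∀ w ∈ W, A w ∈ W) {v : V} (hv : A v ∈ W) : S v ∈ W := by
  rw [Algebra.adjoin_singleton_eq_range_aeval] at hS
  obtain ⟨q, rfl⟩ := hS
  change Polynomial.aeval A q v ∈ W
  change _root_.IsNilpotent (A - Polynomial.aeval A q) at hN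
  set S := Polynomial.aeval A q
  have hSW : ∀ w ∈ W, S w ∈ W := fun w hw ↦
    Polynomial.aeval_apply_smul_mem_of_le_comap hw q A hW
  -- With `S = q(A)` and `A v ∈ W`, only the constant term of `q` matters modulo `W`. It need not be
  -- known to vanish: nilpotency of `A - S` shows that either it is `0` or `v ∈ W`.
  have h1 : S v - q.coeff 0 • v ∈ W := by
    have : S v - q.coeff 0 • v = Polynomial.aeval A q.divX (A v) := by
      simp only [S]
      conv_lhs => rw [← Polynomial.divX_mul_X_add q]
      simp
    rw [this]
    exact Polynomial.aeval_apply_smul_mem_of_le_comap hv _ A hW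
  have h2 : ∀ k : ℕ, ((A - S) ^ k) v - (-q.coeff 0) ^ k • v ∈ W := by
    intro k
    induction k with
    | zero => simp
    | succ k ih =>
      have h3 : (A - S) (((A - S) ^ k) v - (-q.coeff 0) ^ k • v) ∈ W :=
        W.sub_mem (hW _ ih) (hSW _ ih)
      have h4 : (-q.coeff 0) ^ k • (A v - (S v - q.coeff 0 • v)) ∈ W :=
        W.smul_mem _ (W.sub_mem hv h1)
      have := W.add_mem h3 h4
      rw [pow_succ', Module.End.mul_apply, pow_succ, mul_smul]
      convert this using 1
      simp only [map_sub, map_smul, LinearMap.sub_apply]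
      generalize (-q.coeff 0) ^ k = c
      module
  obtain ⟨k, hk⟩ := hN
  have h3 := h2 k
  rw [hk, LinearMap.zero_apply, zero_sub, Submodule.neg_mem_iff] at h3
  by_cases h : q.coeff 0 = 0
  · rwa [h, zero_smul, sub_zero] at h1
  · have hvW : v ∈ W := (W.smul_mem_iff (pow_ne_zero k (neg_ne_zero.mpr h))).mp h3
    exact hSW v hvW

variable {K L : Type*} [Field K] [CharZero K] [LieRing L] [LieAlgebra K L]
  [FiniteDimensional K L] {𝒢 : ℤ → Submodule K L} [GradedLieAlgebra 𝒢]

-- `ad x` shifts degrees by `p ≠ 0`, and only finitely many components are nonzero.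
omit [CharZero K] in
theorem isNilpotent_ad_of_mem_grade {p : ℤ} (hp : p ≠ 0) {x : L} (hx : x ∈ 𝒢 p) :
    _root_.IsNilpotent (ad K L x) := by
  have hfin : {i | 𝒢 i ≠ ⊥}.Finite := WellFoundedGT.finite_ne_bot_of_iSupIndep
    (DirectSum.Decomposition.isInternal 𝒢).submodule_iSupIndep
  rw [Module.End.isNilpotent_iff_of_finite]
  intro v
  have key : v ∈ (ad K L x).maxGenEigenspace 0 := by
    refine map_mem_of_homogeneous (𝒢 := 𝒢) isHomogeneous_top LinearMap.id
      (fun q v _ hv ↦ ?_) v trivial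
    have hmem : ∀ k : ℕ, ((ad K L x) ^ k) v ∈ 𝒢 (k * p + q) := by
      intro k
      induction k with
      | zero => simpa using hv
      | succ k ih =>
        rw [pow_succ', Module.End.mul_apply, ad_apply]
        have := lie_mem_grade hx ih
        rwa [show p + (k * p + q) = ((k + 1 : ℕ) : ℤ) * p + q by push_cast; ring] at this
    obtain ⟨k, hk⟩ : ∃ k : ℕ, 𝒢 (k * p + q) = ⊥ := by
      by_contra! h
      have hinj : Function.Injective fun k : ℕ ↦ (k * p + q : ℤ) := fun a b hab ↦ by
        have : (a * p + q : ℤ) = b * p + q := hab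
        exact_mod_cast mul_right_cancel₀ hp (add_right_cancel this)
      exact Set.infinite_of_injective_forall_mem hinj (s := {i | 𝒢 i ≠ ⊥}) h hfin
    rw [Module.End.mem_maxGenEigenspace]
    refine ⟨k, ?_⟩
    have := hmem k
    rw [hk, Submodule.mem_bot] at this
    simpa using this
  rw [Module.End.mem_maxGenEigenspace] at key
  simpa using key

/-- In a decomposable graded Lie algebra, the Jordan decomposition of a degree zero element of the
radical. -/
theorem exists_semisimple_part (hL : IsDecomposableLie K L) {x : L} (hx : x ∈ radical K L)
    (hx0 : x ∈ 𝒢 0) :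
    ∃ s ∈ radical K L, s ∈ 𝒢 0 ∧ (ad K L s).IsSemisimple ∧
      _root_.IsNilpotent (ad K L (x - s)) ∧ ∀ y : L, ⁅x, y⁆ = 0 → ⁅s, y⁆ = 0 := by
  obtain ⟨N, hN, S, hS, hNn, hSs, hNS⟩ := (ad K L x).exists_isNilpotent_isSemisimple
  have hJC : IsJordanChevalley (ad K L x) S N := by
    refine ⟨hSs, hNn, ?_, by rw [hNS, add_comm]⟩
    rw [Algebra.adjoin_singleton_eq_range_aeval] at hN hS
    obtain ⟨a, rfl⟩ := hN
    obtain ⟨b, rfl⟩ := hS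
    change _ * _ = _ * _
    exact (map_mul (Polynomial.aeval (ad K L x)) b a).symm.trans
      ((congrArg _ (mul_comm b a)).trans (map_mul (Polynomial.aeval (ad K L x)) a b))
  obtain ⟨s₁, hs₁⟩ := (hL (ad K L x) ⟨x, rfl⟩ S N hJC).1
  have hs₁ : ad K L s₁ = S := hs₁
  have hsub : ad K L x - S = N := by rw [hNS, add_sub_cancel_right]
  have hSmem : ∀ (W : Submodule K L), (∀ w ∈ W, ⁅x, w⁆ ∈ W) → ∀ v, ⁅x, v⁆ ∈ W → S v ∈ W :=
    fun W hW v hv ↦ apply_mem_of_isNilpotent_sub hS (by rwa [hsub]) hW hv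
  -- `S` preserves degrees because `ad x` does, so replacing `s₁` by its degree zero part leaves the
  -- inner derivation unchanged.
  let s := gradeProj 𝒢 0 s₁
  have hs : ad K L s = S := by
    refine eq_of_homogeneous (𝒢 := 𝒢) fun q y hy ↦ ?_
    have hdeg : ∀ w ∈ 𝒢 q, ⁅x, w⁆ ∈ 𝒢 q := fun w hw ↦ by
      have := lie_mem_grade hx0 hw
      rwa [zero_add] at this
    have h1 : S y ∈ 𝒢 q := hSmem (𝒢 q) hdeg y (hdeg y hy)
    have h2 := gradeProj_lie_right hy 0 s₁
    rw [zero_add] at h2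
    rw [ad_apply, ← h2, ← ad_apply K, hs₁, gradeProj_of_mem h1]
  have hsapply : ∀ y, ⁅s, y⁆ = S y := fun y ↦ by rw [← hs, ad_apply]
  refine ⟨s, ?_, gradeProj_mem 𝒢 0 s₁, by rwa [hs], ?_, fun y hy ↦ ?_⟩
  · have h1 : ∀ y, ⁅s, y⁆ ∈ radical K L := fun y ↦ by
      rw [hsapply]
      exact hSmem (radical K L).toSubmodule (fun w hw ↦ (radical K L).lie_mem hw) y
        (lie_mem_left K L _ _ _ hx)
    -- `S` maps `L` into the radical, so `s` is central modulo the radical; the semisimple quotient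
    -- has trivial center.
    have h2 : quotHom (radical K L) s ∈ LieAlgebra.center K (L ⧸ radical K L) := by
      rw [LieModule.mem_maxTrivSubmodule]
      intro z
      obtain ⟨z, rfl⟩ := quotHom_surjective _ z
      rw [← LieHom.map_lie, quotHom_eq_zero_iff, ← lie_skew]
      exact (radical K L).neg_mem (h1 z)
    have h3 := center_le_radical K (L ⧸ radical K L) h2
    rw [HasTrivialRadical.radical_eq_bot (R := K) (L := L ⧸ radical K L), LieSubmodule.mem_bot, quotHom_eq_zero_iff] at h3
    exact h3
  · rw [map_sub, hs, hsub]
    exact hNn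
  · have := hSmem ⊥ (fun w hw ↦ by rw [(Submodule.mem_bot K).mp hw, lie_zero]; exact zero_mem _) y
      (by rw [hy]; exact zero_mem _)
    rw [hsapply]
    exact (Submodule.mem_bot K).mp this

/-- The centralizer of a subspace as a Lie subalgebra. -/
def centralizerSubalgebra (t : Submodule K L) : LieSubalgebra K L where
  carrier := {x | ∀ y ∈ t, ⁅y, x⁆ = 0}
  add_mem' ha hb y hy := by rw [lie_add, ha y hy, hb y hy, add_zero]
  zero_mem' y _ := lie_zero y
  smul_mem' a x hx y hy := by rw [lie_smul, hx y hy, smul_zero]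
  lie_mem' {a b} ha hb y hy := by rw [leibniz_lie, ha y hy, hb y hy, zero_lie, lie_zero, add_zero]

omit [CharZero K] [FiniteDimensional K L] in
theorem isHomogeneous_centralizerSubalgebra {t : Submodule K L} (ht : t ≤ 𝒢 0) :
    (centralizerSubalgebra t).toSubmodule.IsHomogeneous 𝒢 := by
  rw [isHomogeneous_iff_gradeProj_mem]
  intro p x hx y hy
  rw [← gradeProj_lie_left (ht hy), hx y hy, map_zero]

/-- A graded maximal torus of the radical: it lies in degree zero, acts semisimply, and its
centralizer in the radical differs from it only by nilpotent elements. -/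
theorem exists_maximal_torus (𝒢 : ℤ → Submodule K L) [GradedLieAlgebra 𝒢]
    (hL : IsDecomposableLie K L) :
    ∃ t : Submodule K L, t ≤ (radical K L).toSubmodule ∧ t ≤ 𝒢 0 ∧
      (∀ x ∈ t, ∀ y ∈ t, ⁅x, y⁆ = 0) ∧ (∀ x ∈ t, (ad K L x).IsSemisimple) ∧
      ∀ x ∈ radical K L, (∀ y ∈ t, ⁅y, x⁆ = 0) → x ∈ t ⊔ (nilIdeal K L).toSubmodule := by
  let P : Set (Submodule K L) := {t | t ≤ (radical K L).toSubmodule ∧ t ≤ 𝒢 0 ∧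
      (∀ x ∈ t, ∀ y ∈ t, ⁅x, y⁆ = 0) ∧ (∀ x ∈ t, (ad K L x).IsSemisimple)}
  have hP : P.Nonempty := ⟨⊥, bot_le, bot_le,
    fun x hx y _ ↦ by rw [(Submodule.mem_bot K).mp hx, zero_lie],
    fun x hx ↦ by
      rw [(Submodule.mem_bot K).mp hx, map_zero]
      exact Module.End.isSemisimple_zero⟩
  obtain ⟨t, ⟨h1, h2, h3, h4⟩, hmax⟩ := (wellFounded_gt (α := Submodule K L)).has_min P hP
  refine ⟨t, h1, h2, h3, h4, fun x hx hxt ↦ ?_⟩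
  refine map_mem_of_homogeneous (isHomogeneous_inf (isHomogeneous_radical 𝒢)
    (isHomogeneous_centralizerSubalgebra h2)) (W := t ⊔ (nilIdeal K L).toSubmodule)
    LinearMap.id (fun p x hx hxp ↦ ?_) x ⟨hx, hxt⟩
  obtain ⟨hx, hxt⟩ := hx
  have hxt : ∀ y ∈ t, ⁅y, x⁆ = 0 := hxt
  by_cases hp : p = 0
  · subst hp
    obtain ⟨s, hs, hs0, hss, hnil, hcomm⟩ := exists_semisimple_part hL hx hxp
    have hst : ∀ y ∈ t, ⁅s, y⁆ = 0 := fun y hy ↦ hcomm y (by rw [← lie_skew, hxt y hy, neg_zero])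
    have hst' : ∀ y ∈ t, ⁅y, s⁆ = 0 := fun y hy ↦ by rw [← lie_skew, hst y hy, neg_zero]
    have hP' : t ⊔ K ∙ s ∈ P := by
      refine ⟨sup_le h1 ((Submodule.span_singleton_le_iff_mem _ _).mpr hs),
        sup_le h2 ((Submodule.span_singleton_le_iff_mem _ _).mpr hs0), ?_, ?_⟩
      · intro a ha b hb
        obtain ⟨a, hat, _, ha', rfl⟩ := Submodule.mem_sup.mp ha
        obtain ⟨b, hbt, _, hb', rfl⟩ := Submodule.mem_sup.mp hb
        obtain ⟨m, rfl⟩ := Submodule.mem_span_singleton.mp ha'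
        obtain ⟨m', rfl⟩ := Submodule.mem_span_singleton.mp hb'
        simp [h3 a hat b hbt, hst b hbt, hst' a hat]
      · intro a ha
        obtain ⟨a, hat, _, ha', rfl⟩ := Submodule.mem_sup.mp ha
        obtain ⟨m, rfl⟩ := Submodule.mem_span_singleton.mp ha'
        rw [map_add, map_smul]
        refine Module.End.IsSemisimple.add_of_commute ?_ (h4 a hat)
          (Module.End.IsSemisimple_smul m hss)
        refine Commute.smul_right ?_ m
        rw [commute_iff_lie_eq, ← LieHom.map_lie, hst' a hat, map_zero]
    have hst'' : s ∈ t := by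
      by_contra h
      exact hmax _ hP' (lt_of_le_of_ne le_sup_left fun h' ↦ h
        (h' ▸ Submodule.mem_sup_right (Submodule.mem_span_singleton_self s)))
    exact Submodule.mem_sup.mpr ⟨s, hst'', x - s,
      mem_nilIdeal_iff.mpr ⟨(radical K L).sub_mem hx hs, hnil⟩, add_sub_cancel s x⟩
  · exact Submodule.mem_sup_right (mem_nilIdeal_iff.mpr ⟨hx, isNilpotent_ad_of_mem_grade hp hxp⟩)

/-- The centralizer of a torus `t` in the radical together with the maximal nilpotent ideal spans
the whole algebra. -/
theorem exists_centralizer_add_nilIdeal {t : Submodule K L} (ht : t ≤ (radical K L).toSubmodule)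
    (hab : ∀ x ∈ t, ∀ y ∈ t, ⁅x, y⁆ = 0) (hss : ∀ x ∈ t, (ad K L x).IsSemisimple) (x : L) :
    ∃ c ∈ centralizerSubalgebra t, ∃ m ∈ nilIdeal K L, c + m = x := by
  let T : LieSubalgebra K L :=
    { t with lie_mem' := fun {a b} ha hb ↦ by rw [hab a ha b hb]; exact t.zero_mem }
  have hT : IsLieAbelian T := ⟨fun a b ↦ Subtype.ext (hab a a.2 b b.2)⟩
  -- By semisimplicity the generalized zero weight space is the centralizer of `t`; the other
  -- Fitting component lies in `[t, L]`, hence in the nilpotent ideal.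
  have hcompl := isCompl_genWeightSpace_zero_posFittingComp K T L
  have hx : x ∈ genWeightSpace L (0 : T → K) ⊔ posFittingComp K T L :=
    hcompl.sup_eq_top ▸ LieSubmodule.mem_top x
  obtain ⟨c, hc, m, hm, rfl⟩ := (LieSubmodule.mem_sup _ _ _).mp hx
  refine ⟨c, fun y hy ↦ ?_, m, ?_, rfl⟩
  · obtain ⟨k, hk⟩ := (mem_genWeightSpace L (0 : T → K) c).mp hc ⟨y, hy⟩
    have h1 : c ∈ (ad K L y).maxGenEigenspace 0 := by
      rw [Module.End.mem_maxGenEigenspace]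
      refine ⟨k, ?_⟩
      rw [zero_smul, sub_zero]
      rwa [Pi.zero_apply, zero_smul, sub_zero] at hk
    rw [(hss y hy).isFinitelySemisimple.maxGenEigenspace_eq_eigenspace,
      Module.End.mem_eigenspace_iff, zero_smul] at h1
    exact h1
  · have hle : (posFittingComp K T L).toSubmodule ≤ (nilIdeal K L).toSubmodule := by
      rw [posFittingComp, LieSubmodule.iSup_toSubmodule, iSup_le_iff]
      intro y v hv
      obtain ⟨w, rfl⟩ := (mem_posFittingCompOf K y v).mp hv 1
      rw [pow_one]
      change ⁅(y : L), w⁆ ∈ nilIdeal K L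
      rw [← lie_skew]
      exact (nilIdeal K L).neg_mem (lie_mem_nilIdeal_of_mem_radical w (ht y.2))
    exact hle hm

/-- A Lie algebra that is spanned by a semisimple subalgebra and central elements is reductive. -/
theorem isReductiveLie_of_eq_sup {l s : LieSubalgebra K L} {t : Submodule K L}
    [HasTrivialRadical K s] (hl : l.toSubmodule = s.toSubmodule ⊔ t)
    (ht : ∀ y ∈ t, ∀ x ∈ l, ⁅y, x⁆ = 0) : IsReductiveLie K l := by
  have hsl : s ≤ l := by
    rw [← LieSubalgebra.toSubmodule_le_toSubmodule, hl]
    exact le_sup_left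
  refine ⟨fun I ↦ ?_⟩
  -- Weyl's theorem for `s` supplies an invariant complement of `I`; it is an ideal because `t` acts
  -- by zero.
  let ρ : s →ₗ⁅K⁆ End K l := (ad K l).comp (LieSubalgebra.inclusion hsl)
  have hρ : ∀ x v, ρ x v = ⁅LieSubalgebra.inclusion hsl x, v⁆ := fun x v ↦ rfl
  obtain ⟨N, hN, hIN⟩ := exists_invariant_isCompl ρ I.toSubmodule fun x v hv ↦ I.lie_mem hv
  let J : LieIdeal K l :=
    { N with
      lie_mem := by
        intro x v hv
        have hx : (x : L) ∈ s.toSubmodule ⊔ t := hl ▸ x.2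
        obtain ⟨a, ha, b, hb, hab⟩ := Submodule.mem_sup.mp hx
        have h1 : ⁅x, v⁆ = ρ ⟨a, ha⟩ v := by
          ext
          rw [hρ]
          change ⁅(x : L), (v : L)⁆ = ⁅a, (v : L)⁆
          rw [← hab, add_lie, ht b hb v v.2, add_zero]
        rw [h1]
        exact hN _ v hv }
  refine ⟨J, ?_⟩
  rw [← LieSubmodule.isCompl_toSubmodule]
  exact hIN

end ReductiveLeviFactor

/-! ### Assembly of the graded reductive Levi factor. -/

theorem mainTheorem12 {K L : Type*} [Field K] [CharZero K] [LieRing L] [LieAlgebra K L]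
    [FiniteDimensional K L] (𝒢 : ℤ → Submodule K L) [GradedLieAlgebra 𝒢]
    (hL : IsDecomposableLie K L) :
    ∃ l : LieSubalgebra K L,
      IsReductiveLie K l ∧
      IsCompl l.toSubmodule (nilIdeal K L).toSubmodule ∧
      l.toSubmodule.IsHomogeneous 𝒢 := by
  obtain ⟨t, htr, ht0, htab, htss, hmax⟩ := exists_maximal_torus 𝒢 hL
  have hcn := exists_centralizer_add_nilIdeal htr htab htss
  set c := centralizerSubalgebra t
  set r := LieAlgebra.radical K L
  have hnr : ∀ x ∈ nilIdeal K L, x ∈ r := fun x hx ↦ (mem_nilIdeal_iff.mp hx).1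
  let p := quotHom r
  have hp : ∀ {x}, p x = 0 ↔ x ∈ r := quotHom_eq_zero_iff r
  have hker : p.ker = r := by
    ext x
    exact hp
  have hsol : LieAlgebra.IsSolvable p.ker := by
    rw [hker]
    infer_instance
  obtain ⟨s, hsc, hs, hps, hs0⟩ := exists_homogeneous_levi p
    (by rw [hker]; exact isHomogeneous_radical 𝒢) c (isHomogeneous_centralizerSubalgebra ht0)
    (fun y ↦ by
      obtain ⟨x, rfl⟩ := quotHom_surjective r y
      obtain ⟨a, ha, m, hm, rfl⟩ := hcn x
      exact ⟨a, ha, by rw [map_add, hp.mpr (hnr m hm), add_zero]⟩)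
  have hsr : LieAlgebra.HasTrivialRadical K s := by
    let e : s ≃ₗ⁅K⁆ L ⧸ r := LieEquiv.ofBijective (p.comp s.incl)
      ⟨(injective_iff_map_eq_zero _).mpr fun x hx ↦ Subtype.ext (hs0 x x.2 hx), fun y ↦ by
        obtain ⟨x, hx, rfl⟩ := hps y
        exact ⟨⟨x, hx⟩, rfl⟩⟩
    have := LieAlgebra.isKilling_of_equiv e.symm
    infer_instance
  -- `t` may meet the nilpotent ideal, in elements that are both ad-semisimple and ad-nilpotent,
  -- hence central. These are split off.
  obtain ⟨u, hu⟩ := Submodule.exists_isCompl ((nilIdeal K L).toSubmodule.comap t.subtype)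
  let t' : Submodule K L := u.map t.subtype
  have ht't : t' ≤ t := Submodule.map_subtype_le t u
  have htt' : ∀ x ∈ t, ∃ m ∈ nilIdeal K L, ∃ y ∈ t', m + y = x := by
    intro x hx
    have : (⟨x, hx⟩ : t) ∈ (nilIdeal K L).toSubmodule.comap t.subtype ⊔ u :=
      hu.sup_eq_top ▸ Submodule.mem_top
    obtain ⟨m, hm, y, hy, hmy⟩ := Submodule.mem_sup.mp this
    exact ⟨m, hm, y, ⟨y, hy, rfl⟩, congrArg Subtype.val hmy⟩
  have ht'n : ∀ x ∈ t', x ∈ nilIdeal K L → x = 0 := by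
    rintro _ ⟨x, hx, rfl⟩ hxn
    have := (Submodule.disjoint_def.mp hu.disjoint) x hxn hx
    rw [this, map_zero]
  have hst : ∀ y ∈ t, ∀ x ∈ s, ⁅y, x⁆ = 0 := fun y hy x hx ↦ hsc hx y hy
  have hcomm : ∀ y ∈ t', ∀ x ∈ s.toSubmodule ⊔ t', ⁅y, x⁆ = 0 := by
    intro y hy x hx
    obtain ⟨a, ha, b, hb, rfl⟩ := Submodule.mem_sup.mp hx
    rw [lie_add, hst y (ht't hy) a ha, htab y (ht't hy) b (ht't hb), add_zero]
  let l : LieSubalgebra K L :=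
    { s.toSubmodule ⊔ t' with
      lie_mem' := by
        intro x y hx hy
        obtain ⟨a, ha, b, hb, rfl⟩ := Submodule.mem_sup.mp hx
        obtain ⟨a', ha', b', hb', rfl⟩ := Submodule.mem_sup.mp hy
        refine Submodule.mem_sup_left ?_
        rw [add_lie, hcomm b hb _ hy, add_zero, lie_add, ← lie_skew a b',
          hst b' (ht't hb') a ha, neg_zero, add_zero]
        exact s.lie_mem ha ha' }
  refine ⟨l, isReductiveLie_of_eq_sup (s := s) (t := t') rfl hcomm, ⟨?_, ?_⟩,
    isHomogeneous_sup hs (isHomogeneous_of_le (ht't.trans ht0))⟩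
  · rw [Submodule.disjoint_def]
    intro x hx hxn
    obtain ⟨a, ha, b, hb, rfl⟩ := Submodule.mem_sup.mp hx
    have har : a ∈ r := by
      have := r.sub_mem (hnr _ hxn) (htr (ht't hb))
      rwa [add_sub_cancel_right] at this
    have ha0 : a = 0 := hs0 a ha (hp.mpr har)
    rw [ha0, zero_add] at hxn ⊢
    exact ht'n b hb hxn
  · rw [codisjoint_iff, eq_top_iff]
    intro x _
    obtain ⟨a, ha, m, hm, rfl⟩ := hcn x
    obtain ⟨σ, hσ, hσa⟩ := hps (p a)
    have h1 : a - σ ∈ r := by rw [← hp, map_sub, hσa, sub_self]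
    -- Both `a` and `σ` centralize `t`, so their difference lies in the centralizer of `t` in the
    -- radical.
    have h2 := hmax (a - σ) h1 (fun y hy ↦ c.sub_mem ha (hsc hσ) y hy)
    obtain ⟨τ, hτ, m', hm', hτm⟩ := Submodule.mem_sup.mp h2
    obtain ⟨m'', hm'', τ', hτ', rfl⟩ := htt' τ hτ
    refine Submodule.mem_sup.mpr ⟨σ + τ', Submodule.add_mem_sup hσ hτ', m'' + m' + m,
      (nilIdeal K L).add_mem ((nilIdeal K L).add_mem hm'' hm') hm, ?_⟩
    linear_combination (norm := module) hτm
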